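/- Let $n>1$ be an integer and let $\alpha_1,\dots,\alpha_n$ be Hermitian $m\times m$ complex matrices with $\alpha_j\alpha_k+\alpha_k\alpha_j=2\delta_{jk}$ for all $j,k$ (for instance with $m=2^{n/2}$ if $n$ is even and $m=2^{(n+1)/2}$ if $n$ is odd). Let $H_0=\sum_{j=1}^n\alpha_jD_j$, $D_j=-i\,\partial/\partial x_j$, be the massless Dirac operator on $\mathbb R^n$, the derivatives being taken in the weak sense. Let $\tau$ be a real number with $\tau\neq 2k-n$ for every $k\in\mathbb Z$. Then the minimum $d:=\min_{k\in\mathbb Z}|\tau+n-2k|$ exists and is positive, and with the positive constant $c=d^2/4$, which depends only on $d$, every function $u$ in the Sobolev space $W^1_2(\mathbb R^n;\mathbb C^m)$ with compact support in $\mathbb R^n\setminus\{0\}$ satisfies $$c\int_{\mathbb R^n}|x|^{\tau}\,|u(x)|^2\,dx\;\le\;\int_{\mathbb R^n}|x|^{\tau+2}\,|H_0u(x)|^2\,dx ,$$ where both integrals are finite. -/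

import Mathlib

open MeasureTheory
open scoped ContDiff

namespace HardyDirac

/-- The domain `ℝⁿ` with its Euclidean norm. -/
abbrev Dom (n : ℕ) : Type := EuclideanSpace ℝ (Fin n)

/-- The spinor space `ℂᵐ` with its Hermitian norm. -/
abbrev Spinor (m : ℕ) : Type := EuclideanSpace ℂ (Fin m)

/-- Hermitian `m × m` matrices `α₁, …, αₙ` with `αⱼ αₖ + αₖ αⱼ = 2 δⱼₖ`. -/
structure IsCliffordFamily {n m : ℕ} (α : Fin n → Matrix (Fin m) (Fin m) ℂ) : Prop where
  isHermitian : ∀ j, (α j).IsHermitian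
  anticomm : ∀ j k, α j * α k + α k * α j = if j = k then (2 : ℂ) • 1 else 0

/-- `g` is the weak (distributional) partial derivative `∂u/∂xⱼ` on the whole of `ℝⁿ`. -/
structure HasWeakPartialDeriv {n m : ℕ} (j : Fin n) (u g : Dom n → Spinor m) : Prop where
  locallyIntegrable : LocallyIntegrable u
  locallyIntegrable_deriv : LocallyIntegrable g
  integral_eq : ∀ φ : Dom n → ℝ, ContDiff ℝ ∞ φ → HasCompactSupport φ →
    ∫ x, φ x • g x = -∫ x, (fderiv ℝ φ x (EuclideanSpace.single j 1)) • u x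

/-- Weak partial derivatives are unique up to null sets. -/
theorem HasWeakPartialDeriv.ae_eq {n m : ℕ} {j : Fin n} {u g g' : Dom n → Spinor m}
    (h : HasWeakPartialDeriv j u g) (h' : HasWeakPartialDeriv j u g') : g =ᵐ[volume] g' :=
  ae_eq_of_integral_contDiff_smul_eq h.locallyIntegrable_deriv h'.locallyIntegrable_deriv
    fun φ hφ hc => (h.integral_eq φ hφ hc).trans (h'.integral_eq φ hφ hc).symm

open Classical in
/-- The weak partial derivative `∂u/∂xⱼ` (a representative of it; zero if there is none). -/
noncomputable def weakPartialDeriv {n m : ℕ} (j : Fin n) (u : Dom n → Spinor m) :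
    Dom n → Spinor m :=
  if h : ∃ g, HasWeakPartialDeriv j u g then h.choose else 0

/-- Any weak partial derivative agrees almost everywhere with the chosen representative. -/
theorem HasWeakPartialDeriv.weakPartialDeriv_ae_eq {n m : ℕ} {j : Fin n}
    {u g : Dom n → Spinor m} (h : HasWeakPartialDeriv j u g) :
    weakPartialDeriv j u =ᵐ[volume] g := by
  have hex : ∃ g, HasWeakPartialDeriv j u g := ⟨g, h⟩
  rw [weakPartialDeriv, dif_pos hex]
  exact hex.choose_spec.ae_eq h

/-- The Sobolev space `W¹₂(ℝⁿ; ℂᵐ)`: square-integrable functions all of whose first-order weak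
partial derivatives exist and are square-integrable. -/
def MemW12 {n m : ℕ} (u : Dom n → Spinor m) : Prop :=
  MemLp u 2 ∧ ∀ j, ∃ g, HasWeakPartialDeriv j u g ∧ MemLp g 2

/-- `u` has compact support in `ℝⁿ ∖ {0}` (the support of a class of functions modulo equality
almost everywhere). -/
def HasCompactSupportAwayFromZero {n m : ℕ} (u : Dom n → Spinor m) : Prop :=
  ∃ K : Set (Dom n), IsCompact K ∧ (0 : Dom n) ∉ K ∧ ∀ᵐ x, x ∉ K → u x = 0

/-- The massless Dirac operator `H₀ = ∑ⱼ αⱼ Dⱼ` with `Dⱼ = -i ∂/∂xⱼ`. -/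
noncomputable def masslessDirac {n m : ℕ} (α : Fin n → Matrix (Fin m) (Fin m) ℂ)
    (u : Dom n → Spinor m) (x : Dom n) : Spinor m :=
  ∑ j, (α j).toEuclideanLin ((-Complex.I) • weakPartialDeriv j u x)

/-- The set of the numbers `|τ + n - 2k|` for integers `k`. -/
def gapSet (n : ℕ) (τ : ℝ) : Set ℝ :=
  Set.range fun k : ℤ => |τ + n - 2 * k|

/-- `d = min_k |τ + n - 2k|`, the infimum of `gapSet n τ`. -/
noncomputable def gap (n : ℕ) (τ : ℝ) : ℝ :=
  sInf (gapSet n τ)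

end HardyDirac

/-! Write `D = ∑ αⱼ∂ⱼ`, `X = ∑ αⱼxⱼ`, `E = ∑ xⱼ∂ⱼ` and `Γ = XD - E`. As `X` is Hermitian with `X² =
|x|²`, the right-hand integrand is `|x|^τ |XDu|²`. The operator `Γ` is angular: it commutes with `E`
and is symmetric for every radial weight. With `v = |x|^{τ/2} u` one has `|x|^{τ/2} XDu = (E + Γ -
τ/2) v`. Since `E + n/2` is skew-symmetric in `L²`, on an eigenspace `Γ = μ` this has norm at least
`|μ - (τ+n)/2| ‖v‖`. The eigenvalues that occur are integers, so the factor is at least `d/2`.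

The spectral decomposition of `Γ` is only needed on polynomials. There it is the Fischer
decomposition (`mem_span_monogenicSet`), a consequence of `DX + XD = n + 2E`. Distinct eigenspaces
are orthogonal for all radial weights (`pairing_eq_zero`), so for fields `θ(|x|²)P` with `P`
polynomial the estimate reduces to a single eigenspace (`hardyForm_self_nonneg_of_mem`,
`hardy_homogeneousSum`).

To reach Sobolev functions, `u` is convolved with a polynomial that is uniformly close to a
mollifier. The result `P` is a polynomial, and `DP` is the same convolution applied to the weak
`Du`; hence `P` approximates `u` and `DP` approximates `Du` in `L²` of a ball
(`exists_polyConv_near`, `MemW12.exists_homogeneousSum_polyConv`). `MemW12.hardy` passes to the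
limit; the profile `θ(t) = t^{τ/4}` near the squared radii of the support of `u` then yields the
weight. -/

namespace HardyDirac

/-! ### Commutation relations in an abstract Weyl–Clifford algebra -/

section Weyl

variable {R : Type*} [Ring R] {ι : Type*} [Fintype ι]

/-- Generators of a Weyl algebra together with a commuting Clifford algebra. -/
structure IsWeylClifford [DecidableEq ι] (a x d : ι → R) : Prop where
  ax : ∀ i j, a i * x j = x j * a i
  ad : ∀ i j, a i * d j = d j * a i
  xx : ∀ i j, x i * x j = x j * x i
  dd : ∀ i j, d i * d j = d j * d i
  dx : ∀ i j, d i * x j = x j * d i + if i = j then 1 else 0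
  sq : ∀ i, a i * a i = 1
  anti : ∀ i j, i ≠ j → a i * a j + a j * a i = 0

variable [DecidableEq ι] {a x d : ι → R}

/-- For `i ≠ j` the Weyl factors commute and the Clifford anticommutator kills the term; each
diagonal term contributes `1 + 2 xᵢdᵢ`. -/
theorem IsWeylClifford.dirac_anticomm (h : IsWeylClifford a x d) :
    (∑ i, a i * d i) * (∑ i, a i * x i) + (∑ i, a i * x i) * (∑ i, a i * d i) =
      (Fintype.card ι : R) + 2 * ∑ i, x i * d i := by
  rw [Finset.sum_mul_sum, Finset.sum_mul_sum, Finset.sum_comm (γ := ι), ← Finset.sum_add_distrib]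
  have key : ∀ j i, a i * d i * (a j * x j) + a j * x j * (a i * d i) =
      if i = j then 1 + 2 * (x i * d i) else 0 := by
    intro j i
    have e1 : a i * d i * (a j * x j) = a i * a j * (d i * x j) := by
      rw [mul_assoc, ← mul_assoc (d i), ← h.ad, mul_assoc, mul_assoc]
    have e2 : a j * x j * (a i * d i) = a j * a i * (x j * d i) := by
      rw [mul_assoc, ← mul_assoc (x j), ← h.ax, mul_assoc, mul_assoc]
    rw [e1, e2, h.dx]
    by_cases hij : i = j
    · subst hij
      simp only [if_true, h.sq]
      noncomm_ring
    · simp only [hij, if_false, add_zero, ← add_mul, h.anti i j hij, zero_mul]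
  simp only [← Finset.sum_add_distrib, key]
  simp [Finset.sum_add_distrib, Finset.mul_sum]

/-- Algebraic form of the fact that the Dirac operator lowers homogeneity by one degree;
`euler_position` is the raising counterpart. -/
theorem IsWeylClifford.euler_dirac (h : IsWeylClifford a x d) :
    (∑ i, x i * d i) * (∑ i, a i * d i) =
      (∑ i, a i * d i) * (∑ i, x i * d i) - ∑ i, a i * d i := by
  rw [Finset.sum_mul_sum, Finset.sum_mul_sum, Finset.sum_comm (γ := ι), eq_sub_iff_add_eq,
    ← Finset.sum_add_distrib]
  refine Finset.sum_congr rfl fun j _ => ?_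
  have key : ∀ i, a j * d j * (x i * d i) =
      x i * d i * (a j * d j) + if i = j then a j * d j else 0 := by
    intro i
    have e1 : a j * d j * (x i * d i) = a j * (d j * x i) * d i := by noncomm_ring
    have e2 : x i * d i * (a j * d j) = a j * (x i * d j) * d i := by
      rw [mul_assoc, ← mul_assoc (d i), ← h.ad, mul_assoc, h.dd, ← mul_assoc, ← h.ax]
      noncomm_ring
    rw [e1, e2, h.dx]
    by_cases hij : i = j
    · subst hij; simp only [if_true]; noncomm_ring
    · simp [hij, Ne.symm hij]
  simp [key, Finset.sum_add_distrib]

theorem IsWeylClifford.euler_position (h : IsWeylClifford a x d) :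
    (∑ i, x i * d i) * (∑ i, a i * x i) =
      (∑ i, a i * x i) * (∑ i, x i * d i) + ∑ i, a i * x i := by
  rw [Finset.sum_mul_sum, Finset.sum_mul_sum, Finset.sum_comm (γ := ι),
    ← Finset.sum_add_distrib]
  refine Finset.sum_congr rfl fun j _ => ?_
  have key : ∀ i, x i * d i * (a j * x j) =
      a j * x j * (x i * d i) + if i = j then a j * x j else 0 := by
    intro i
    have e1 : x i * d i * (a j * x j) = a j * (x i * (d i * x j)) := by
      rw [mul_assoc, ← mul_assoc (d i), ← h.ad, mul_assoc, ← mul_assoc, ← h.ax]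
      noncomm_ring
    have e2 : a j * x j * (x i * d i) = a j * ((x i * x j) * d i) := by
      rw [h.xx i j]; noncomm_ring
    rw [e1, e2, h.dx]
    by_cases hij : i = j
    · subst hij; simp only [if_true]; noncomm_ring
    · simp [hij, mul_assoc]
  simp [key, Finset.sum_add_distrib]

end Weyl

/-! ### Smooth spinor fields and the operators acting on them -/

/-- The submodule of smooth functions in the space of all spinor fields on `ℝⁿ`. -/
def smoothSubmodule (n m : ℕ) : Submodule ℂ (Dom n → Spinor m) where
  carrier := {f | ContDiff ℝ ∞ f}
  add_mem' {f g} hf hg := by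
    have hf' : ContDiff ℝ ∞ f := hf
    have hg' : ContDiff ℝ ∞ g := hg
    exact hf'.add hg'
  zero_mem' := by
    change ContDiff ℝ ∞ fun _ => (0 : Spinor m)
    exact contDiff_const
  smul_mem' c f hf := by
    have hf' : ContDiff ℝ ∞ f := hf
    exact hf'.const_smul c

/-- The space of smooth spinor fields on `ℝⁿ`. -/
def Smooth (n m : ℕ) : Type := smoothSubmodule n m

noncomputable instance (n m : ℕ) : AddCommGroup (Smooth n m) :=
  inferInstanceAs (AddCommGroup (smoothSubmodule n m))

noncomputable instance (n m : ℕ) : Module ℂ (Smooth n m) :=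
  inferInstanceAs (Module ℂ (smoothSubmodule n m))

variable {n m : ℕ}

@[ext] theorem Smooth.ext {f g : Smooth n m} (h : f.1 = g.1) : f = g := Subtype.ext h

@[simp] theorem Smooth.val_add (f g : Smooth n m) : (f + g).1 = f.1 + g.1 := rfl

@[simp] theorem Smooth.val_sub (f g : Smooth n m) : (f - g).1 = f.1 - g.1 := rfl

@[simp] theorem Smooth.val_zero : (0 : Smooth n m).1 = 0 := rfl

@[simp] theorem Smooth.val_smul (c : ℂ) (f : Smooth n m) : (c • f).1 = c • f.1 := rfl

@[simp] theorem Smooth.val_sum {ι : Type*} (s : Finset ι) (f : ι → Smooth n m) :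
    (∑ i ∈ s, f i).1 = ∑ i ∈ s, (f i).1 :=
  map_sum (AddMonoidHom.mk' (fun f : Smooth n m => f.1) fun _ _ => rfl) f s

/-- A smooth function as an element of `Smooth n m`. -/
def Smooth.mk (f : Dom n → Spinor m) (hf : ContDiff ℝ ∞ f) : Smooth n m := ⟨f, hf⟩

@[simp] theorem Smooth.val_mk (f : Dom n → Spinor m) (hf : ContDiff ℝ ∞ f) :
    (Smooth.mk f hf).1 = f := rfl

theorem Smooth.contDiff (f : Smooth n m) : ContDiff ℝ ∞ f.1 := f.2

theorem Smooth.differentiable (f : Smooth n m) : Differentiable ℝ f.1 :=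
  (f.contDiff).differentiable (by simp)

/-- The `j`-th partial derivative as an operator on smooth spinor fields. -/
noncomputable def partialOp (j : Fin n) : Module.End ℂ (Smooth n m) where
  toFun f := Smooth.mk (fun x => fderiv ℝ f.1 x (EuclideanSpace.single j 1)) (by
    have h : ContDiff ℝ ∞ (fderiv ℝ f.1) := (f.contDiff).fderiv_right le_rfl
    exact h.clm_apply contDiff_const)
  map_add' f g := by
    ext1; funext x
    simp [fderiv_add (f.differentiable x) (g.differentiable x)]
  map_smul' c f := by
    ext1; funext x
    simp [fderiv_const_smul (f.differentiable x)]

/-- Multiplication by the `j`-th coordinate. -/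
noncomputable def coordOp (j : Fin n) : Module.End ℂ (Smooth n m) where
  toFun f := Smooth.mk (fun x => x j • f.1 x) (by
    have : ContDiff ℝ ∞ fun x : Dom n => x j := by fun_prop
    exact this.smul f.contDiff)
  map_add' f g := by ext1; funext x; simp
  map_smul' c f := by ext1; funext x; exact smul_comm (x j) c (f.1 x)

/-- Pointwise application of a matrix. -/
noncomputable def matrixOp (A : Matrix (Fin m) (Fin m) ℂ) : Module.End ℂ (Smooth n m) where
  toFun f := Smooth.mk (fun x => A.toEuclideanLin (f.1 x)) (by
    exact ((A.toEuclideanLin.restrictScalars ℝ).toContinuousLinearMap.contDiff).comp f.contDiff)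
  map_add' f g := by ext1; funext x; exact map_add _ _ _
  map_smul' c f := by ext1; funext x; exact map_smul A.toEuclideanLin c (f.1 x)

theorem partialOp_apply (j : Fin n) (f : Smooth n m) (x : Dom n) :
    (partialOp j f).1 x = fderiv ℝ f.1 x (EuclideanSpace.single j 1) := rfl

theorem coordOp_apply (j : Fin n) (f : Smooth n m) (x : Dom n) :
    (coordOp j f).1 x = x j • f.1 x := rfl

theorem matrixOp_apply (A : Matrix (Fin m) (Fin m) ℂ) (f : Smooth n m) (x : Dom n) :
    (matrixOp A f).1 x = A.toEuclideanLin (f.1 x) := rfl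

theorem matrixOp_mul_apply (A B : Matrix (Fin m) (Fin m) ℂ) (f : Smooth n m) (x : Dom n) :
    ((matrixOp A * matrixOp B : Module.End ℂ (Smooth n m)) f).1 x = (A * B).toEuclideanLin (f.1 x) := by
  simp [matrixOp_apply, Matrix.toLpLin_mul_same]

theorem hasFDerivAt_coord (j : Fin n) (x : Dom n) :
    HasFDerivAt (fun y : Dom n => y j) (EuclideanSpace.proj j : Dom n →L[ℝ] ℝ) x :=
  (EuclideanSpace.proj j : Dom n →L[ℝ] ℝ).hasFDerivAt

theorem IsCliffordFamily.sq {α : Fin n → Matrix (Fin m) (Fin m) ℂ} (hα : IsCliffordFamily α)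
    (j : Fin n) : α j * α j = 1 := by
  have h := hα.anticomm j j
  rw [if_pos rfl, ← two_smul ℂ] at h
  exact smul_right_injective _ (two_ne_zero' ℂ) h

theorem isWeylClifford {α : Fin n → Matrix (Fin m) (Fin m) ℂ} (hα : IsCliffordFamily α) :
    IsWeylClifford (R := Module.End ℂ (Smooth n m)) (fun j => matrixOp (α j)) coordOp
      partialOp where
  ax i j := by ext1 f; ext1; funext x; simp [matrixOp_apply, coordOp_apply]
  ad i j := by
    ext1 f; ext1; funext x
    simp only [Module.End.mul_apply, matrixOp_apply, partialOp_apply]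
    have := ((α i).toEuclideanLin.restrictScalars ℝ).toContinuousLinearMap.hasFDerivAt.comp x
      (f.differentiable x).hasFDerivAt
    have e := this.fderiv
    have e' := congrArg (fun T => T (EuclideanSpace.single j 1)) e
    exact e'.symm
  xx i j := by ext1 f; ext1; funext x; exact smul_comm _ _ _
  dd i j := by
    ext1 f; ext1; funext x
    have hd : DifferentiableAt ℝ (fderiv ℝ f.1) x :=
      ((f.contDiff).fderiv_right (m := ∞) le_rfl).differentiable (by simp) x
    have hs : IsSymmSndFDerivAt ℝ f.1 x :=
      (f.contDiff).contDiffAt.isSymmSndFDerivAt (by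
        rw [minSmoothness_of_isRCLikeNormedField]; exact WithTop.coe_le_coe.2 (le_top : (2 : ℕ∞) ≤ ⊤))
    have key : ∀ v w : Dom n, fderiv ℝ (fun y => fderiv ℝ f.1 y v) x w =
        fderiv ℝ (fderiv ℝ f.1) x w v := fun v w => by
      rw [fderiv_clm_apply hd (differentiableAt_const v)]
      simp
    exact (key _ _).trans ((hs.eq _ _).trans (key _ _).symm)
  dx i j := by
    ext1 f; ext1; funext x
    have e := ((hasFDerivAt_coord j x).smul (f.differentiable x).hasFDerivAt).fderiv
    have e' := congrArg (fun T => T (EuclideanSpace.single i 1)) e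
    have e2 : (partialOp i (coordOp j f)).1 x = _ := e'
    simp only [Module.End.mul_apply, e2]
    by_cases hij : i = j
    · subst hij
      simp [coordOp_apply, partialOp_apply]
    · simp [coordOp_apply, partialOp_apply, hij, Ne.symm hij]
  sq i := by
    ext1 f; ext1; funext x
    have h := matrixOp_mul_apply (α i) (α i) f x
    rw [hα.sq] at h
    simpa using h
  anti i j hij := by
    have h := hα.anticomm i j
    rw [if_neg hij] at h
    ext1 f; ext1; funext x
    have e := congrArg₂ (· + ·) (matrixOp_mul_apply (α i) (α j) f x)
      (matrixOp_mul_apply (α j) (α i) f x)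
    simp only [← LinearMap.add_apply, ← map_add, h] at e
    simpa using e

/-- The operator `∑ⱼ αⱼ ∂ⱼ`. -/
noncomputable def diracOp (α : Fin n → Matrix (Fin m) (Fin m) ℂ) : Module.End ℂ (Smooth n m) :=
  ∑ j, matrixOp (α j) * partialOp j

/-- The operator `∑ⱼ αⱼ xⱼ`. -/
noncomputable def positionOp (α : Fin n → Matrix (Fin m) (Fin m) ℂ) :
    Module.End ℂ (Smooth n m) :=
  ∑ j, matrixOp (α j) * coordOp j

/-- The Euler operator `∑ⱼ xⱼ ∂ⱼ`. -/
noncomputable def eulerOp (n m : ℕ) : Module.End ℂ (Smooth n m) :=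
  ∑ j, coordOp j * partialOp j

/-- The angular part of the Dirac operator. -/
noncomputable def gammaOp (α : Fin n → Matrix (Fin m) (Fin m) ℂ) : Module.End ℂ (Smooth n m) :=
  positionOp α * diracOp α - eulerOp n m

/-- Gives the action of `DX` on a joint eigenvector of `E` and `Γ`, and also the term needed for the
symmetry of `Γ`. -/
theorem dirac_mul_position {α : Fin n → Matrix (Fin m) (Fin m) ℂ} (hα : IsCliffordFamily α) :
    diracOp α * positionOp α = (n : Module.End ℂ (Smooth n m)) + eulerOp n m - gammaOp α := by
  have h := (isWeylClifford hα).dirac_anticomm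
  rw [Fintype.card_fin] at h
  change diracOp α * positionOp α + positionOp α * diracOp α = _ + 2 * eulerOp n m at h
  rw [gammaOp, eq_sub_of_add_eq h]
  noncomm_ring

theorem euler_mul_dirac {α : Fin n → Matrix (Fin m) (Fin m) ℂ} (hα : IsCliffordFamily α) :
    eulerOp n m * diracOp α = diracOp α * eulerOp n m - diracOp α :=
  (isWeylClifford hα).euler_dirac

theorem euler_mul_position {α : Fin n → Matrix (Fin m) (Fin m) ℂ} (hα : IsCliffordFamily α) :
    eulerOp n m * positionOp α = positionOp α * eulerOp n m + positionOp α :=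
  (isWeylClifford hα).euler_position

/-- `X` raises the degree by one and `D` lowers it by one, so `XD` preserves it. -/
theorem euler_mul_gamma {α : Fin n → Matrix (Fin m) (Fin m) ℂ} (hα : IsCliffordFamily α) :
    eulerOp n m * gammaOp α = gammaOp α * eulerOp n m := by
  rw [gammaOp, mul_sub, sub_mul, ← mul_assoc, euler_mul_position hα, add_mul, mul_assoc,
    euler_mul_dirac hα]
  noncomm_ring

/-! ### Fischer decomposition and eigenspaces of the angular operator -/

theorem clm_apply_eq_sum {V : Type*} [NormedAddCommGroup V] [NormedSpace ℝ V]
    (L : Dom n →L[ℝ] V) (x : Dom n) : L x = ∑ j, x j • L (EuclideanSpace.single j 1) := by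
  have h := congrArg L ((EuclideanSpace.basisFun (Fin n) ℝ).sum_repr x)
  simpa using h.symm

theorem eulerOp_apply (f : Smooth n m) (x : Dom n) :
    (eulerOp n m f).1 x = fderiv ℝ f.1 x x := by
  rw [clm_apply_eq_sum (fderiv ℝ f.1 x) x]
  simp only [eulerOp, LinearMap.sum_apply, Smooth.val_sum, Finset.sum_apply]
  refine Finset.sum_congr rfl fun j _ => ?_
  simp [coordOp_apply, partialOp_apply]

theorem eq_const_of_euler_eq_zero {f : Smooth n m} (hf : eulerOp n m f = 0) (x : Dom n) :
    f.1 x = f.1 0 := by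
  have hd : ∀ t : ℝ, HasDerivAt (fun s : ℝ => f.1 (s • x)) (fderiv ℝ f.1 (t • x) x) t := by
    intro t
    have h1 : HasDerivAt (fun s : ℝ => s • x) x t := by
      simpa using (hasDerivAt_id t).smul_const x
    exact (f.differentiable (t • x)).hasFDerivAt.comp_hasDerivAt t h1
  -- Euler's equation at `t • x` gives `t` times the derivative along the ray; dividing needs `t ≠
  -- 0`, and continuity of the derivative supplies `t = 0`.
  have hz : (fun t : ℝ => fderiv ℝ f.1 (t • x) x) = fun _ => 0 := by
    refine Continuous.ext_on (dense_compl_singleton (0 : ℝ)) ?_ continuous_const ?_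
    · have h : Continuous (fderiv ℝ f.1) := (f.contDiff).continuous_fderiv (by simp)
      exact (h.comp (by fun_prop)).clm_apply continuous_const
    · intro t ht
      have h := eulerOp_apply f (t • x)
      rw [hf, map_smul] at h
      exact (smul_eq_zero.1 h.symm).resolve_left ht
  have hc := is_const_of_deriv_eq_zero (fun t => (hd t).differentiableAt)
    (fun t => (hd t).deriv.trans (congrFun hz t)) 1 0
  simpa using hc

theorem dirac_eq_zero_of_euler_eq_zero (α : Fin n → Matrix (Fin m) (Fin m) ℂ)
    {f : Smooth n m} (hf : eulerOp n m f = 0) : diracOp α f = 0 := by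
  have hc : f.1 = fun _ => f.1 0 := funext (eq_const_of_euler_eq_zero hf)
  have hp : ∀ j, partialOp j f = 0 := by
    intro j; ext1; funext x
    rw [partialOp_apply, hc]; simp
  simp [diracOp, hp]

/-- Homogeneous spinor fields of degree `k` which are eigenvectors of `(α·x)(α·∂)` with an
eigenvalue in `[0, n + 2k)`. -/
def monogenicSet (α : Fin n → Matrix (Fin m) (Fin m) ℂ) (k : ℕ) : Set (Smooth n m) :=
  {Q | eulerOp n m Q = (k : ℂ) • Q ∧
    ∃ ν : ℕ, ν < n + 2 * k ∧ positionOp α (diracOp α Q) = (ν : ℂ) • Q}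

/-- `XQ` is a preimage up to a scalar: on a generator of degree `k` with eigenvalue `ν`, `DX = n + E
- Γ` acts as `n + 2k - ν`, which the bound in `monogenicSet` makes nonzero. Moreover `XQ` has degree
`k + 1` and eigenvalue `n + 2k - ν`, which satisfies the bound for `k + 1`, so the construction can
be iterated. -/
theorem exists_dirac_eq {α : Fin n → Matrix (Fin m) (Fin m) ℂ} (hα : IsCliffordFamily α)
    {k : ℕ} {Q : Smooth n m} (hQ : Q ∈ Submodule.span ℂ (monogenicSet α k)) :
    ∃ Q' ∈ Submodule.span ℂ (monogenicSet α (k + 1)), diracOp α Q' = Q := by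
  induction hQ using Submodule.span_induction with
  | mem Q hQ =>
    obtain ⟨hE, ν, hν, hXD⟩ := hQ
    have hG : gammaOp α Q = ((ν : ℂ) - k) • Q := by
      simp [gammaOp, hXD, hE, sub_smul]
    have hDX : diracOp α (positionOp α Q) = ((n + 2 * k - ν : ℕ) : ℂ) • Q := by
      have h := congrArg (fun T : Module.End ℂ (Smooth n m) => T Q) (dirac_mul_position hα)
      simp only [Module.End.mul_apply, LinearMap.sub_apply, LinearMap.add_apply, hE, hG,
        Module.End.natCast_apply] at h
      rw [h, ← Nat.cast_smul_eq_nsmul ℂ, ← add_smul, ← sub_smul, Nat.cast_sub hν.le]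
      push_cast
      congr 1; ring
    have hne : ((n + 2 * k - ν : ℕ) : ℂ) ≠ 0 := by
      exact_mod_cast (Nat.sub_pos_of_lt hν).ne'
    refine ⟨((n + 2 * k - ν : ℕ) : ℂ)⁻¹ • positionOp α Q,
      Submodule.smul_mem _ _ (Submodule.subset_span ⟨?_, n + 2 * k - ν, by omega, ?_⟩), ?_⟩
    · have h := congrArg (fun T : Module.End ℂ (Smooth n m) => T Q) (euler_mul_position hα)
      simp only [Module.End.mul_apply, LinearMap.add_apply, hE, map_smul] at h
      rw [h]; push_cast; rw [add_smul, one_smul]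
    · rw [hDX, map_smul]
    · rw [map_smul, hDX, smul_smul, inv_mul_cancel₀ hne, one_smul]
  | zero => exact ⟨0, Submodule.zero_mem _, map_zero _⟩
  | add P Q _ _ hP hQ =>
    obtain ⟨P', hP', rfl⟩ := hP
    obtain ⟨Q', hQ', rfl⟩ := hQ
    exact ⟨P' + Q', Submodule.add_mem _ hP' hQ', map_add _ _ _⟩
  | smul c P _ hP =>
    obtain ⟨P', hP', rfl⟩ := hP
    exact ⟨c • P', Submodule.smul_mem _ _ hP', map_smul _ _ _⟩

/-- Fischer decomposition of homogeneous spinor fields. -/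
theorem mem_span_monogenicSet {α : Fin n → Matrix (Fin m) (Fin m) ℂ} (hα : IsCliffordFamily α)
    (hn : 0 < n) (k : ℕ) {P : Smooth n m} (hP : eulerOp n m P = (k : ℂ) • P) :
    P ∈ Submodule.span ℂ (monogenicSet α k) := by
  -- A field killed by `D` has `ν = 0`, admissible even in degree `0` because `n > 0`.
  have hker : ∀ (k : ℕ) {P : Smooth n m}, eulerOp n m P = (k : ℂ) • P → diracOp α P = 0 →
      P ∈ Submodule.span ℂ (monogenicSet α k) := fun k P hP hD =>
    Submodule.subset_span ⟨hP, 0, by omega, by simp [hD]⟩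
  induction k generalizing P with
  | zero => exact hker 0 hP (dirac_eq_zero_of_euler_eq_zero α (by simpa using hP))
  | succ k ih =>
    have hD : eulerOp n m (diracOp α P) = (k : ℂ) • diracOp α P := by
      have h := congrArg (fun T : Module.End ℂ (Smooth n m) => T P) (euler_mul_dirac hα)
      simp only [Module.End.mul_apply, LinearMap.sub_apply, hP, map_smul] at h
      rw [h]; push_cast; rw [add_smul, one_smul, add_sub_cancel_right]
    -- Subtracting a preimage `Q` of `DP` taken from the span leaves a remainder killed by `D`.
    obtain ⟨Q, hQ, hDQ⟩ := exists_dirac_eq hα (ih hD)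
    have hQE : eulerOp n m Q = ((k + 1 : ℕ) : ℂ) • Q := by
      have hle : Submodule.span ℂ (monogenicSet α (k + 1)) ≤
          LinearMap.ker (eulerOp n m - ((k + 1 : ℕ) : ℂ) • LinearMap.id) := by
        rw [Submodule.span_le]
        rintro R ⟨hR, -⟩
        simp [hR]
      have h := hle hQ
      rw [LinearMap.mem_ker, LinearMap.sub_apply, sub_eq_zero] at h
      simpa using h
    have h := hker (k + 1) (P := P - Q) (by rw [map_sub, hP, hQE, smul_sub])
      (by rw [map_sub, hDQ, sub_self])
    simpa using Submodule.add_mem _ h hQ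

/-- The eigenspace of the angular operator for the eigenvalue `μ`. -/
noncomputable def gammaEigenspace (α : Fin n → Matrix (Fin m) (Fin m) ℂ) (μ : ℤ) :
    Submodule ℂ (Smooth n m) :=
  LinearMap.ker (gammaOp α - (μ : ℂ) • LinearMap.id)

theorem mem_gammaEigenspace {α : Fin n → Matrix (Fin m) (Fin m) ℂ} {μ : ℤ} {P : Smooth n m} :
    P ∈ gammaEigenspace α μ ↔ gammaOp α P = (μ : ℂ) • P := by
  rw [gammaEigenspace, LinearMap.mem_ker, LinearMap.sub_apply, sub_eq_zero]
  rfl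

theorem euler_mem_gammaEigenspace {α : Fin n → Matrix (Fin m) (Fin m) ℂ}
    (hα : IsCliffordFamily α) {μ : ℤ} {P : Smooth n m} (hP : P ∈ gammaEigenspace α μ) :
    eulerOp n m P ∈ gammaEigenspace α μ := by
  rw [mem_gammaEigenspace] at hP ⊢
  have h := congrArg (fun T : Module.End ℂ (Smooth n m) => T P) (euler_mul_gamma hα)
  simp only [Module.End.mul_apply, hP, map_smul] at h
  exact h.symm

/-- Finite sums of homogeneous smooth spinor fields. -/
noncomputable def homogeneousSum (n m : ℕ) : Submodule ℂ (Smooth n m) :=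
  Submodule.span ℂ {P | ∃ k : ℕ, eulerOp n m P = (k : ℂ) • P}

/-- In degree `k` a generator has `XD = ν`, hence `Γ = ν - k`: this is where integrality of the
spectrum comes from. -/
theorem homogeneousSum_le_iSup {α : Fin n → Matrix (Fin m) (Fin m) ℂ}
    (hα : IsCliffordFamily α) (hn : 0 < n) :
    homogeneousSum n m ≤ ⨆ μ : ℤ, gammaEigenspace α μ := by
  rw [homogeneousSum, Submodule.span_le]
  rintro P ⟨k, hP⟩
  have hle : Submodule.span ℂ (monogenicSet α k) ≤ ⨆ μ : ℤ, gammaEigenspace α μ := by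
    rw [Submodule.span_le]
    rintro Q ⟨hE, ν, -, hXD⟩
    refine Submodule.mem_iSup_of_mem ((ν : ℤ) - k) ?_
    rw [mem_gammaEigenspace]
    simp [gammaOp, hXD, hE, sub_smul]
  exact hle (mem_span_monogenicSet hα hn k hP)

/-- Multiplication by a coordinate raises the degree by one; this closure lets convolutions with
polynomials be built up inside `homogeneousSum`. -/
theorem coord_mem_homogeneousSum (j : Fin n) {P : Smooth n m} (hP : P ∈ homogeneousSum n m) :
    coordOp j P ∈ homogeneousSum n m := by
  induction hP using Submodule.span_induction with
  | mem P hP =>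
    obtain ⟨k, hk⟩ := hP
    refine Submodule.subset_span ⟨k + 1, ?_⟩
    ext1; funext x
    have e := ((hasFDerivAt_coord j x).smul (P.differentiable x).hasFDerivAt).fderiv
    have e' := congrArg (fun T => T x) e
    have hk' := congrArg (fun f : Smooth n m => f.1 x) hk
    simp only [eulerOp_apply] at hk' ⊢
    refine e'.trans ?_
    simp [hk', coordOp_apply, add_smul, smul_comm (x j) (k : ℂ)]
  | zero => simp
  | add P Q _ _ hP hQ => rw [map_add]; exact Submodule.add_mem _ hP hQ
  | smul c P _ hP => rw [map_smul]; exact Submodule.smul_mem _ _ hP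

/-- The constant spinor fields. -/
def constField (n : ℕ) (v : Spinor m) : Smooth n m := Smooth.mk (fun _ => v) contDiff_const

theorem constField_mem_homogeneousSum (v : Spinor m) : constField n v ∈ homogeneousSum n m := by
  refine Submodule.subset_span ⟨0, ?_⟩
  ext1; funext x
  rw [eulerOp_apply]
  simp [constField]

/-! ### Radially weighted pairings and integration by parts -/

/-- A smooth compactly supported function of one real variable. -/
structure IsProfile (ψ : ℝ → ℝ) : Prop where
  contDiff : ContDiff ℝ ∞ ψ
  hasCompactSupport : HasCompactSupport ψ

theorem IsProfile.mul {φ ψ : ℝ → ℝ} (hφ : IsProfile φ) (hψ : IsProfile ψ) :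
    IsProfile fun t => φ t * ψ t :=
  ⟨hφ.contDiff.mul hψ.contDiff, hφ.hasCompactSupport.mul_right⟩

theorem IsProfile.deriv {ψ : ℝ → ℝ} (hψ : IsProfile ψ) : IsProfile (deriv ψ) :=
  ⟨(contDiff_infty_iff_deriv.1 hψ.contDiff).2, hψ.hasCompactSupport.deriv⟩

theorem IsProfile.contDiff_mul {φ ψ : ℝ → ℝ} (hφ : ContDiff ℝ ∞ φ) (hψ : IsProfile ψ) :
    IsProfile fun t => φ t * ψ t :=
  ⟨hφ.mul hψ.contDiff, hψ.hasCompactSupport.mul_left⟩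

theorem IsProfile.contDiff_radial {ψ : ℝ → ℝ} (hψ : IsProfile ψ) (n : ℕ) :
    ContDiff ℝ ∞ fun x : Dom n => ψ (‖x‖ ^ 2) :=
  hψ.contDiff.comp (contDiff_norm_sq ℝ)

theorem IsProfile.hasCompactSupport_radial {ψ : ℝ → ℝ} (hψ : IsProfile ψ) (n : ℕ) :
    HasCompactSupport fun x : Dom n => ψ (‖x‖ ^ 2) := by
  obtain ⟨R, hR⟩ := hψ.hasCompactSupport.isCompact.isBounded.subset_closedBall 0
  refine HasCompactSupport.intro (isCompact_closedBall (0 : Dom n) (|R| + 1)) fun x hx => ?_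
  refine image_eq_zero_of_notMem_tsupport fun h => hx ?_
  have h1 := hR h
  rw [Metric.mem_closedBall, dist_zero_right, Real.norm_of_nonneg (by positivity)] at h1
  rw [Metric.mem_closedBall, dist_zero_right]
  nlinarith [norm_nonneg x, le_abs_self R, abs_nonneg R]

theorem IsProfile.integrable {V : Type*} [NormedAddCommGroup V] [NormedSpace ℝ V] {ψ : ℝ → ℝ}
    (hψ : IsProfile ψ) {f : Dom n → V} (hf : Continuous f) :
    Integrable fun x => ψ (‖x‖ ^ 2) • f x :=
  ((hψ.contDiff_radial n).continuous.smul hf).integrable_of_hasCompactSupport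
    (hψ.hasCompactSupport_radial n).smul_right

theorem fderiv_radial {ψ : ℝ → ℝ} (hψ : IsProfile ψ) (x v : Dom n) :
    fderiv ℝ (fun y : Dom n => ψ (‖y‖ ^ 2)) x v = 2 * inner ℝ x v * deriv ψ (‖x‖ ^ 2) := by
  have h1 : HasFDerivAt (fun y : Dom n => ‖y‖ ^ 2) (2 • (innerSL ℝ x)) x :=
    (hasStrictFDerivAt_norm_sq x).hasFDerivAt
  have h2 : HasDerivAt ψ (deriv ψ (‖x‖ ^ 2)) (‖x‖ ^ 2) :=
    (hψ.contDiff.differentiable (by simp) _).hasDerivAt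
  have h3 := (h2.comp_hasFDerivAt x h1).fderiv
  change fderiv ℝ (ψ ∘ fun y : Dom n => ‖y‖ ^ 2) x v = _
  rw [h3]
  simp
  ring

theorem inner_single_right (x : Dom n) (j : Fin n) :
    inner ℝ x (EuclideanSpace.single j (1 : ℝ)) = x j := by
  simp [EuclideanSpace.inner_single_right]

/-- The weighted divergence theorem. -/
theorem integral_radial_divergence {ψ : ℝ → ℝ} (hψ : IsProfile ψ) {V : Fin n → Dom n → ℂ}
    (hV : ∀ k, ContDiff ℝ ∞ (V k)) :
    ∫ x, ψ (‖x‖ ^ 2) • ∑ k, fderiv ℝ (V k) x (EuclideanSpace.single k 1) =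
      -∫ x, deriv ψ (‖x‖ ^ 2) • ((2 : ℝ) • ∑ k, x k • V k x) := by
  have hc : ∀ k, Continuous fun x => fderiv ℝ (V k) x (EuclideanSpace.single k 1) := fun k =>
    ((hV k).continuous_fderiv (by simp)).clm_apply continuous_const
  have hk : ∀ k, ∫ x, ψ (‖x‖ ^ 2) • fderiv ℝ (V k) x (EuclideanSpace.single k 1) =
      -∫ x, deriv ψ (‖x‖ ^ 2) • ((2 : ℝ) • x k • V k x) := by
    intro k
    have hcoord : Continuous fun x : Dom n => (2 : ℝ) • x k • V k x := by
      have := (hV k).continuous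
      fun_prop
    have e : (fun x => fderiv ℝ (fun y : Dom n => ψ (‖y‖ ^ 2)) x (EuclideanSpace.single k 1) •
        V k x) = fun x => deriv ψ (‖x‖ ^ 2) • ((2 : ℝ) • x k • V k x) := by
      funext x
      rw [fderiv_radial hψ, inner_single_right, smul_smul, smul_smul]
      congr 1; ring
    rw [← e]
    refine integral_smul_fderiv_eq_neg_fderiv_smul_of_integrable ?_ (hψ.integrable (hc k))
      (hψ.integrable (hV k).continuous)
      (fun x _ => (hψ.contDiff_radial n).differentiable (by simp) x)
      (fun x _ => (hV k).differentiable (by simp) x)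
    rw [e]
    exact hψ.deriv.integrable hcoord
  simp only [Finset.smul_sum]
  rw [integral_finsetSum _ fun k _ => hψ.integrable (hc k), integral_finsetSum,
    ← Finset.sum_neg_distrib]
  · exact Finset.sum_congr rfl fun k _ => hk k
  · intro k _
    refine hψ.deriv.integrable ?_
    have := (hV k).continuous
    fun_prop

theorem continuous_inner_smooth (P Q : Smooth n m) :
    Continuous fun x => inner ℂ (P.1 x) (Q.1 x) :=
  P.contDiff.continuous.inner Q.contDiff.continuous

/-- The `L²` pairing of smooth spinor fields with a radial weight. -/
noncomputable def pairing (ψ : ℝ → ℝ) (P Q : Smooth n m) : ℂ :=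
  ∫ x, ψ (‖x‖ ^ 2) • inner ℂ (P.1 x) (Q.1 x)

theorem pairing_add_left {ψ : ℝ → ℝ} (hψ : IsProfile ψ) (P P' Q : Smooth n m) :
    pairing ψ (P + P') Q = pairing ψ P Q + pairing ψ P' Q := by
  rw [pairing, pairing, pairing, ← integral_add (hψ.integrable (continuous_inner_smooth P Q))
    (hψ.integrable (continuous_inner_smooth P' Q))]
  congr 1; funext x
  simp

theorem pairing_add_right {ψ : ℝ → ℝ} (hψ : IsProfile ψ) (P Q Q' : Smooth n m) :
    pairing ψ P (Q + Q') = pairing ψ P Q + pairing ψ P Q' := by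
  rw [pairing, pairing, pairing, ← integral_add (hψ.integrable (continuous_inner_smooth P Q))
    (hψ.integrable (continuous_inner_smooth P Q'))]
  congr 1; funext x
  simp

theorem pairing_smul_left (ψ : ℝ → ℝ) (c : ℂ) (P Q : Smooth n m) :
    pairing ψ (c • P) Q = starRingEnd ℂ c * pairing ψ P Q := by
  rw [pairing, pairing, ← integral_const_mul]
  congr 1; funext x
  simp; ring

theorem pairing_smul_right (ψ : ℝ → ℝ) (c : ℂ) (P Q : Smooth n m) :
    pairing ψ P (c • Q) = c * pairing ψ P Q := by
  rw [pairing, pairing, ← integral_const_mul]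
  congr 1; funext x
  simp; ring

/-- The sum `∑ₖ ⟨Pₖ, Rₖ⟩` of weighted pairings against partial derivatives. -/
theorem pairing_divergence {ψ : ℝ → ℝ} (hψ : IsProfile ψ) (P : Smooth n m)
    (R : Fin n → Smooth n m) :
    ∫ x, ψ (‖x‖ ^ 2) • ∑ k, inner ℂ ((partialOp k P).1 x) ((R k).1 x) =
      -pairing ψ P (∑ k, partialOp k (R k)) -
        pairing (fun t => 2 * deriv ψ t) P (∑ k, coordOp k (R k)) := by
  have h := integral_radial_divergence hψ (V := fun k x => inner ℂ (P.1 x) ((R k).1 x))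
    fun k => P.contDiff.inner ℂ (R k).contDiff
  have e : ∀ x k, fderiv ℝ (fun x => inner ℂ (P.1 x) ((R k).1 x)) x (EuclideanSpace.single k 1) =
      inner ℂ ((partialOp k P).1 x) ((R k).1 x) + inner ℂ (P.1 x) ((partialOp k (R k)).1 x) := by
    intro x k
    rw [fderiv_inner_apply ℂ (P.differentiable x) ((R k).differentiable x), add_comm]
    rfl
  simp only [e, Finset.sum_add_distrib, smul_add] at h
  rw [integral_add] at h
  · rw [eq_sub_of_add_eq h, pairing, pairing]
    rw [sub_eq_add_neg, add_comm, sub_eq_add_neg]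
    congr 2
    · congr 1; funext x
      rw [Smooth.val_sum, Finset.sum_apply, inner_sum]
    · congr 1; funext x
      rw [Smooth.val_sum, Finset.sum_apply, inner_sum, smul_smul, mul_comm]
      congr 1
      refine Finset.sum_congr rfl fun k _ => ?_
      rw [coordOp_apply, inner_smul_right_eq_smul]
  · exact hψ.integrable (continuous_finsetSum _ fun k _ => continuous_inner_smooth _ _)
  · exact hψ.integrable (continuous_finsetSum _ fun k _ => continuous_inner_smooth _ _)

theorem sum_partial_coord (Q : Smooth n m) :
    ∑ k, partialOp k (coordOp k Q) = (n : ℂ) • Q + eulerOp n m Q := by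
  have e : ∀ k, partialOp k (coordOp k Q) = Q + coordOp k (partialOp k Q) := by
    intro k
    ext1; funext x
    have e := ((hasFDerivAt_coord k x).smul (Q.differentiable x).hasFDerivAt).fderiv
    have e' := congrArg (fun T => T (EuclideanSpace.single k 1)) e
    refine Eq.trans e' ?_
    simp [coordOp_apply, partialOp_apply, add_comm]
  simp only [e, Finset.sum_add_distrib, eulerOp, LinearMap.sum_apply, Module.End.mul_apply]
  simp [← Nat.cast_smul_eq_nsmul ℂ]

theorem sum_coord_coord_apply (Q : Smooth n m) (x : Dom n) :
    (∑ k, coordOp k (coordOp k Q)).1 x = ‖x‖ ^ 2 • Q.1 x := by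
  simp only [Smooth.val_sum, Finset.sum_apply, coordOp_apply, smul_smul, ← Finset.sum_smul]
  rw [EuclideanSpace.real_norm_sq_eq]
  simp only [sq]

/-- Integration by parts against the fields `xₖQ`: the formal adjoint of `E` is `-n - E`, and the
last term comes from `E` hitting the weight, since `E(ψ(|x|²)) = 2tψ'(t)` at `t = |x|²`. -/
theorem pairing_euler {ψ : ℝ → ℝ} (hψ : IsProfile ψ) (P Q : Smooth n m) :
    pairing ψ (eulerOp n m P) Q = -(n : ℂ) * pairing ψ P Q - pairing ψ P (eulerOp n m Q) -
      pairing (fun t => 2 * t * deriv ψ t) P Q := by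
  have h := pairing_divergence hψ P fun k => coordOp k Q
  have e1 : ∀ x, ∑ k, inner ℂ ((partialOp k P).1 x) ((coordOp k Q).1 x) =
      inner ℂ ((eulerOp n m P).1 x) (Q.1 x) := by
    intro x
    rw [eulerOp, LinearMap.sum_apply, Smooth.val_sum, Finset.sum_apply, sum_inner]
    refine Finset.sum_congr rfl fun k _ => ?_
    rw [Module.End.mul_apply, coordOp_apply, coordOp_apply, inner_smul_right_eq_smul,
      inner_smul_left_eq_smul]
  simp only [e1] at h
  rw [pairing, h, sum_partial_coord, pairing_add_right hψ, pairing_smul_right]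
  have e2 : pairing (fun t => 2 * deriv ψ t) P (∑ k, coordOp k (coordOp k Q)) =
      pairing (fun t => 2 * t * deriv ψ t) P Q := by
    rw [pairing, pairing]
    congr 1; funext x
    rw [sum_coord_coord_apply, inner_smul_right_eq_smul, smul_smul]
    congr 1; ring
  rw [e2]; ring

/-- Clifford multiplication by the vector `x`. -/
noncomputable def cliffordMul (α : Fin n → Matrix (Fin m) (Fin m) ℂ) (x : Dom n) :
    Spinor m →ₗ[ℂ] Spinor m :=
  ∑ j, (x j : ℂ) • (α j).toEuclideanLin

theorem positionOp_apply (α : Fin n → Matrix (Fin m) (Fin m) ℂ) (f : Smooth n m) (x : Dom n) :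
    (positionOp α f).1 x = cliffordMul α x (f.1 x) := by
  simp only [positionOp, cliffordMul, LinearMap.sum_apply, Smooth.val_sum, Finset.sum_apply,
    Module.End.mul_apply, matrixOp_apply, coordOp_apply, LinearMap.smul_apply]
  refine Finset.sum_congr rfl fun k _ => ?_
  rw [← Complex.coe_smul, map_smul]

theorem IsCliffordFamily.inner_left {α : Fin n → Matrix (Fin m) (Fin m) ℂ}
    (hα : IsCliffordFamily α) (j : Fin n) (v w : Spinor m) :
    inner ℂ ((α j).toEuclideanLin v) w = inner ℂ v ((α j).toEuclideanLin w) :=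
  (Matrix.isSymmetric_toEuclideanLin_iff.2 (hα.isHermitian j)) v w

theorem inner_cliffordMul_left {α : Fin n → Matrix (Fin m) (Fin m) ℂ} (hα : IsCliffordFamily α)
    (x : Dom n) (v w : Spinor m) :
    inner ℂ (cliffordMul α x v) w = inner ℂ v (cliffordMul α x w) := by
  simp only [cliffordMul, LinearMap.sum_apply, sum_inner, inner_sum, LinearMap.smul_apply,
    inner_smul_left, inner_smul_right, Complex.conj_ofReal, hα.inner_left]

theorem cliffordMul_cliffordMul {α : Fin n → Matrix (Fin m) (Fin m) ℂ}
    (hα : IsCliffordFamily α) (x : Dom n) (v : Spinor m) :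
    cliffordMul α x (cliffordMul α x v) = ‖x‖ ^ 2 • v := by
  have h : cliffordMul α x * cliffordMul α x = ((‖x‖ ^ 2 : ℝ) : ℂ) • 1 := by
    have hc : cliffordMul α x = (∑ j, (x j : ℂ) • α j).toEuclideanLin := by
      rw [cliffordMul, map_sum]
      exact Finset.sum_congr rfl fun k _ => (map_smul _ _ _).symm
    have hsq : (∑ j, (x j : ℂ) • α j) * (∑ j, (x j : ℂ) • α j) = ((‖x‖ ^ 2 : ℝ) : ℂ) • 1 := by
      -- Doubling the square and swapping the indices in one copy makes the anticommutators appear.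
      have h2 : (2 : ℂ) • ((∑ j, (x j : ℂ) • α j) * (∑ j, (x j : ℂ) • α j)) =
          (2 : ℂ) • (((‖x‖ ^ 2 : ℝ) : ℂ) • 1) := by
        rw [two_smul]
        conv_lhs => rw [Finset.sum_mul_sum]
        conv_lhs => enter [2]; rw [Finset.sum_comm]
        rw [← Finset.sum_add_distrib]
        simp only [← Finset.sum_add_distrib]
        have e : ∀ i j, (x i : ℂ) • α i * (x j : ℂ) • α j + (x j : ℂ) • α j * (x i : ℂ) • α i =
            if i = j then ((x i : ℂ) * x j) • ((2 : ℂ) • 1) else 0 := by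
          intro i j
          rw [smul_mul_smul_comm, smul_mul_smul_comm, mul_comm (x j : ℂ), ← smul_add,
            hα.anticomm]
          split_ifs <;> simp
        simp only [e, Finset.sum_ite_eq, Finset.mem_univ, if_true, ← Finset.sum_smul]
        rw [smul_comm, EuclideanSpace.real_norm_sq_eq]
        push_cast
        simp only [sq]
      exact smul_right_injective _ (two_ne_zero' ℂ) h2
    rw [hc, Module.End.mul_eq_comp, ← Matrix.toLpLin_mul_same, hsq, map_smul,
      Matrix.toLpLin_one]
    rfl
  have h' := congrArg (fun T : Module.End ℂ (Spinor m) => T v) h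
  rw [← Complex.coe_smul]
  exact h'

theorem norm_cliffordMul {α : Fin n → Matrix (Fin m) (Fin m) ℂ} (hα : IsCliffordFamily α)
    (x : Dom n) (v : Spinor m) : ‖cliffordMul α x v‖ = ‖x‖ * ‖v‖ := by
  have h : ‖cliffordMul α x v‖ ^ 2 = (‖x‖ * ‖v‖) ^ 2 := by
    have e := inner_cliffordMul_left hα x v (cliffordMul α x v)
    rw [cliffordMul_cliffordMul hα, inner_smul_right_eq_smul] at e
    have e' := congrArg RCLike.re e
    rwa [RCLike.smul_re, inner_self_eq_norm_sq, inner_self_eq_norm_sq, ← mul_pow] at e'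
  exact (pow_left_inj₀ (norm_nonneg _) (by positivity) two_ne_zero).1 h

/-- Integrate by parts against the fields `αₖXQ - xₖQ`. Their radial component is `X²Q - |x|²Q = 0`,
so the derivative of the weight never enters and the symmetry holds for every radial weight. Their
divergence is `DXQ - nQ - EQ = -ΓQ`. -/
theorem pairing_gamma {α : Fin n → Matrix (Fin m) (Fin m) ℂ} (hα : IsCliffordFamily α)
    {ψ : ℝ → ℝ} (hψ : IsProfile ψ) (P Q : Smooth n m) :
    pairing ψ (gammaOp α P) Q = pairing ψ P (gammaOp α Q) := by
  have h := pairing_divergence hψ P fun k => matrixOp (α k) (positionOp α Q) - coordOp k Q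
  have e1 : ∀ x, ∑ k, inner ℂ ((partialOp k P).1 x)
      ((matrixOp (α k) (positionOp α Q) - coordOp k Q).1 x) =
      inner ℂ ((gammaOp α P).1 x) (Q.1 x) := by
    intro x
    rw [gammaOp, LinearMap.sub_apply, Smooth.val_sub, Pi.sub_apply, inner_sub_left,
      Module.End.mul_apply, positionOp_apply, inner_cliffordMul_left hα, ← positionOp_apply,
      diracOp, eulerOp, LinearMap.sum_apply, LinearMap.sum_apply, Smooth.val_sum,
      Smooth.val_sum, Finset.sum_apply, Finset.sum_apply, sum_inner, sum_inner,
      ← Finset.sum_sub_distrib]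
    refine Finset.sum_congr rfl fun k _ => ?_
    rw [Smooth.val_sub, Pi.sub_apply, inner_sub_right, Module.End.mul_apply, Module.End.mul_apply,
      coordOp_apply, coordOp_apply, matrixOp_apply, matrixOp_apply, hα.inner_left,
      inner_smul_right_eq_smul, inner_smul_left_eq_smul]
  have e2 : ∑ k, partialOp k (matrixOp (α k) (positionOp α Q) - coordOp k Q) =
      (-1 : ℂ) • gammaOp α Q := by
    have hD : ∑ k, partialOp k (matrixOp (α k) (positionOp α Q)) =
        diracOp α (positionOp α Q) := by
      rw [diracOp, LinearMap.sum_apply]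
      refine Finset.sum_congr rfl fun k _ => ?_
      exact (congrArg (fun T : Module.End ℂ (Smooth n m) => T (positionOp α Q))
        ((isWeylClifford hα).ad k k)).symm
    have hDX := congrArg (fun T : Module.End ℂ (Smooth n m) => T Q) (dirac_mul_position hα)
    simp only [Module.End.mul_apply, LinearMap.sub_apply, LinearMap.add_apply,
      Module.End.natCast_apply, ← Nat.cast_smul_eq_nsmul ℂ] at hDX
    simp only [map_sub, Finset.sum_sub_distrib]
    rw [hD, sum_partial_coord, hDX, neg_one_smul]
    abel
  have e3 : ∑ k, coordOp k (matrixOp (α k) (positionOp α Q) - coordOp k Q) = 0 := by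
    ext1; funext x
    have hX : ∑ k, coordOp k (matrixOp (α k) (positionOp α Q)) =
        positionOp α (positionOp α Q) := by
      conv_rhs => rw [positionOp, LinearMap.sum_apply]
      refine Finset.sum_congr rfl fun k _ => ?_
      exact (congrArg (fun T : Module.End ℂ (Smooth n m) => T (positionOp α Q))
        ((isWeylClifford hα).ax k k)).symm
    simp only [map_sub, Finset.sum_sub_distrib]
    rw [hX, Smooth.val_sub, Pi.sub_apply, sum_coord_coord_apply, positionOp_apply,
      positionOp_apply, cliffordMul_cliffordMul hα, sub_self]
    rfl
  simp only [e1] at h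
  rw [e2, e3, pairing_smul_right] at h
  rw [pairing, h]
  have e0 : pairing (fun t => 2 * deriv ψ t) P (0 : Smooth n m) = 0 := by simp [pairing]
  rw [e0]; ring

/-- Eigenspaces of the angular operator are orthogonal for every radial weight. -/
theorem pairing_eq_zero {α : Fin n → Matrix (Fin m) (Fin m) ℂ} (hα : IsCliffordFamily α)
    {ψ : ℝ → ℝ} (hψ : IsProfile ψ) {μ ν : ℤ} (hne : μ ≠ ν) {P Q : Smooth n m}
    (hP : P ∈ gammaEigenspace α μ) (hQ : Q ∈ gammaEigenspace α ν) : pairing ψ P Q = 0 := by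
  have h := pairing_gamma hα hψ P Q
  rw [mem_gammaEigenspace.1 hP, mem_gammaEigenspace.1 hQ, pairing_smul_left, pairing_smul_right,
    map_intCast] at h
  have h' : ((μ : ℂ) - ν) * pairing ψ P Q = 0 := by rw [sub_mul, h, sub_self]
  refine (mul_eq_zero.1 h').resolve_left (sub_ne_zero.2 ?_)
  exact_mod_cast hne

theorem pairing_conj (ψ : ℝ → ℝ) (P Q : Smooth n m) :
    starRingEnd ℂ (pairing ψ P Q) = pairing ψ Q P := by
  rw [pairing, pairing, ← integral_conj]
  congr 1; funext x
  simp

/-- The real part of `pairing`. -/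
noncomputable def realPairing (ψ : ℝ → ℝ) (P Q : Smooth n m) : ℝ := (pairing ψ P Q).re

theorem realPairing_comm (ψ : ℝ → ℝ) (P Q : Smooth n m) :
    realPairing ψ P Q = realPairing ψ Q P := by
  rw [realPairing, realPairing, ← pairing_conj, Complex.conj_re]

theorem realPairing_add_right {ψ : ℝ → ℝ} (hψ : IsProfile ψ) (P Q Q' : Smooth n m) :
    realPairing ψ P (Q + Q') = realPairing ψ P Q + realPairing ψ P Q' := by
  rw [realPairing, pairing_add_right hψ]; rfl

theorem realPairing_add_left {ψ : ℝ → ℝ} (hψ : IsProfile ψ) (P P' Q : Smooth n m) :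
    realPairing ψ (P + P') Q = realPairing ψ P Q + realPairing ψ P' Q := by
  rw [realPairing, pairing_add_left hψ]; rfl

theorem realPairing_smul_right (ψ : ℝ → ℝ) (c : ℝ) (P Q : Smooth n m) :
    realPairing ψ P ((c : ℂ) • Q) = c * realPairing ψ P Q := by
  rw [realPairing, pairing_smul_right, Complex.re_ofReal_mul]; rfl

theorem realPairing_smul_left (ψ : ℝ → ℝ) (c : ℝ) (P Q : Smooth n m) :
    realPairing ψ ((c : ℂ) • P) Q = c * realPairing ψ P Q := by
  rw [realPairing_comm, realPairing_smul_right, realPairing_comm]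

theorem realPairing_eq_integral {ψ : ℝ → ℝ} (hψ : IsProfile ψ) (P Q : Smooth n m) :
    realPairing ψ P Q = ∫ x, ψ (‖x‖ ^ 2) * (inner ℂ (P.1 x) (Q.1 x)).re := by
  rw [realPairing, pairing]
  refine (integral_re (hψ.integrable (continuous_inner_smooth P Q))).symm.trans ?_
  congr 1; funext x
  exact RCLike.smul_re _ _

theorem integral_norm_sq_eq_realPairing {φ ζ : ℝ → ℝ} (hφ : IsProfile φ) (hζ : IsProfile ζ)
    (A B : Smooth n m) :
    ∫ x, ‖φ (‖x‖ ^ 2) • A.1 x + ζ (‖x‖ ^ 2) • B.1 x‖ ^ 2 =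
      realPairing (fun t => φ t * φ t) A A + 2 * realPairing (fun t => φ t * ζ t) A B +
        realPairing (fun t => ζ t * ζ t) B B := by
  have hi : ∀ {ψ : ℝ → ℝ} (_ : IsProfile ψ) (P Q : Smooth n m),
      Integrable fun x => ψ (‖x‖ ^ 2) * (inner ℂ (P.1 x) (Q.1 x)).re := fun hψ P Q =>
    hψ.integrable (Complex.continuous_re.comp (continuous_inner_smooth P Q))
  rw [realPairing_eq_integral (hφ.mul hφ), realPairing_eq_integral (hφ.mul hζ),
    realPairing_eq_integral (hζ.mul hζ), ← integral_const_mul, ← integral_add (hi (hφ.mul hφ) A A)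
    ((hi (hφ.mul hζ) A B).const_mul 2), ← integral_add]
  · congr 1; funext x
    have hr : ∀ v : Spinor m, (inner ℂ v v).re = ‖v‖ ^ 2 := fun v => inner_self_eq_norm_sq (𝕜 := ℂ) v
    rw [hr, hr, @norm_add_sq ℂ, norm_smul, norm_smul, inner_smul_left_eq_smul,
      inner_smul_right_eq_smul, RCLike.smul_re, RCLike.smul_re, mul_pow, mul_pow, Real.norm_eq_abs,
      Real.norm_eq_abs, sq_abs, sq_abs]
    change _ + 2 * (_ * (_ * (inner ℂ (A.1 x) (B.1 x)).re)) + _ = _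
    ring
  · exact (hi (hφ.mul hφ) A A).add ((hi (hφ.mul hζ) A B).const_mul 2)
  · exact hi (hζ.mul hζ) B B

/-! ### The quadratic form and the inequality on polynomial fields -/

/-- The conjugated operator `(α·x)(α·∂) - τ/2`. -/
noncomputable def shiftedOp (α : Fin n → Matrix (Fin m) (Fin m) ℂ) (τ : ℝ) :
    Module.End ℂ (Smooth n m) :=
  positionOp α * diracOp α - ((τ / 2 : ℝ) : ℂ) • LinearMap.id

theorem shiftedOp_eq {α : Fin n → Matrix (Fin m) (Fin m) ℂ} (τ : ℝ) {μ : ℤ} {P : Smooth n m}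
    (hP : P ∈ gammaEigenspace α μ) :
    shiftedOp α τ P = eulerOp n m P + ((μ - τ / 2 : ℝ) : ℂ) • P := by
  have h := mem_gammaEigenspace.1 hP
  rw [gammaOp, LinearMap.sub_apply, sub_eq_iff_eq_add] at h
  rw [shiftedOp, LinearMap.sub_apply, h, LinearMap.smul_apply, LinearMap.id_apply]
  push_cast
  module

/-- The profile `2 t θ'(t)`. -/
noncomputable def eulerProfile (θ : ℝ → ℝ) (t : ℝ) : ℝ := 2 * t * deriv θ t

theorem IsProfile.euler {θ : ℝ → ℝ} (hθ : IsProfile θ) : IsProfile (eulerProfile θ) :=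
  IsProfile.contDiff_mul (by fun_prop) hθ.deriv

/-- For `v = θ(|x|²)P` one has `Ev = θ EP + 2tθ' P`, so this is `Re ⟨v, (E + n/2)v⟩ = 0`, the
skew-symmetry of `E + n/2`. -/
theorem realPairing_euler {θ : ℝ → ℝ} (hθ : IsProfile θ) (P : Smooth n m) :
    realPairing (fun t => θ t * θ t) P (eulerOp n m P) +
      realPairing (fun t => θ t * eulerProfile θ t) P P =
      -(n / 2 : ℝ) * realPairing (fun t => θ t * θ t) P P := by
  have h := congrArg Complex.re (pairing_euler (hθ.mul hθ) P P)
  have e : (fun t => 2 * t * deriv (fun t => θ t * θ t) t) =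
      fun t => 2 * (θ t * eulerProfile θ t) := by
    funext t
    have hd := hθ.contDiff.differentiable (by simp) t
    rw [deriv_fun_mul hd hd, eulerProfile]
    ring
  have e2 : pairing (fun t => 2 * (θ t * eulerProfile θ t)) P P =
      2 * pairing (fun t => θ t * eulerProfile θ t) P P := by
    rw [pairing, pairing, ← integral_const_mul]
    congr 1; funext x
    rw [mul_smul, Complex.real_smul]; simp
  rw [e, e2] at h
  have hn : (-(n : ℂ) * pairing (fun t => θ t * θ t) P P).re =
      -(n : ℝ) * realPairing (fun t => θ t * θ t) P P := by
    rw [realPairing, ← Complex.re_ofReal_mul]; push_cast; rfl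
  have h2 : (2 * pairing (fun t => θ t * eulerProfile θ t) P P).re =
      2 * realPairing (fun t => θ t * eulerProfile θ t) P P := by
    rw [realPairing, ← Complex.re_ofReal_mul]; push_cast; rfl
  rw [Complex.sub_re, Complex.sub_re, hn, h2] at h
  change realPairing _ _ _ = _ - realPairing _ _ _ - _ at h
  rw [realPairing_comm] at h
  linarith

/-- The polarization of `∫ |θ A + 2 t θ' P|² - c ∫ θ² |P|²` with `A = ((α·x)(α·∂) - τ/2) P`. -/
noncomputable def hardyForm (α : Fin n → Matrix (Fin m) (Fin m) ℂ) (τ c : ℝ) (θ : ℝ → ℝ)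
    (P Q : Smooth n m) : ℝ :=
  realPairing (fun t => θ t * θ t) (shiftedOp α τ P) (shiftedOp α τ Q) +
    (realPairing (fun t => θ t * eulerProfile θ t) (shiftedOp α τ P) Q +
      realPairing (fun t => θ t * eulerProfile θ t) P (shiftedOp α τ Q)) +
    realPairing (fun t => eulerProfile θ t * eulerProfile θ t) P Q -
    c * realPairing (fun t => θ t * θ t) P Q

theorem hardyForm_add_left (α : Fin n → Matrix (Fin m) (Fin m) ℂ) (τ c : ℝ) {θ : ℝ → ℝ}
    (hθ : IsProfile θ) (P P' Q : Smooth n m) :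
    hardyForm α τ c θ (P + P') Q = hardyForm α τ c θ P Q + hardyForm α τ c θ P' Q := by
  simp only [hardyForm, map_add, realPairing_add_left (hθ.mul hθ),
    realPairing_add_left (hθ.mul hθ.euler), realPairing_add_left (hθ.euler.mul hθ.euler)]
  ring

theorem hardyForm_add_right (α : Fin n → Matrix (Fin m) (Fin m) ℂ) (τ c : ℝ) {θ : ℝ → ℝ}
    (hθ : IsProfile θ) (P Q Q' : Smooth n m) :
    hardyForm α τ c θ P (Q + Q') = hardyForm α τ c θ P Q + hardyForm α τ c θ P Q' := by
  simp only [hardyForm, map_add, realPairing_add_right (hθ.mul hθ),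
    realPairing_add_right (hθ.mul hθ.euler), realPairing_add_right (hθ.euler.mul hθ.euler)]
  ring

theorem hardyForm_sum (α : Fin n → Matrix (Fin m) (Fin m) ℂ) (τ c : ℝ) {θ : ℝ → ℝ}
    (hθ : IsProfile θ) {ι : Type*} (s : Finset ι) (f : ι → Smooth n m) :
    hardyForm α τ c θ (∑ i ∈ s, f i) (∑ i ∈ s, f i) =
      ∑ i ∈ s, ∑ j ∈ s, hardyForm α τ c θ (f i) (f j) := by
  rw [show hardyForm α τ c θ (∑ i ∈ s, f i) (∑ i ∈ s, f i) =
    ∑ i ∈ s, hardyForm α τ c θ (f i) (∑ i ∈ s, f i) from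
    map_sum (AddMonoidHom.mk' (fun P => hardyForm α τ c θ P (∑ i ∈ s, f i))
      fun P P' => hardyForm_add_left α τ c hθ P P' _) f s]
  exact Finset.sum_congr rfl fun i _ =>
    map_sum (AddMonoidHom.mk' (hardyForm α τ c θ (f i)) (hardyForm_add_right α τ c hθ _)) f s

/-- On this eigenspace the operator applied to `v = θP` is `l` plus the skew operator `E + n/2`, so
its squared norm is at least `l² ‖v‖²`. -/
theorem hardyForm_self_nonneg_of_mem (α : Fin n → Matrix (Fin m) (Fin m) ℂ) {τ c : ℝ}
    {θ : ℝ → ℝ} (hθ : IsProfile θ) {μ : ℤ} (hc : c ≤ (μ - (τ + n) / 2) ^ 2) {P : Smooth n m}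
    (hP : P ∈ gammaEigenspace α μ) : 0 ≤ hardyForm α τ c θ P P := by
  set l : ℝ := μ - (τ + n) / 2 with hl
  have hnn : 0 ≤ realPairing (fun t => θ t * θ t) P P := by
    rw [realPairing_eq_integral (hθ.mul hθ)]
    refine integral_nonneg fun x => mul_nonneg (mul_self_nonneg _) ?_
    exact inner_self_nonneg (𝕜 := ℂ)
  -- Subtracting `l θP` isolates the skew part `(E + n/2)(θP)`; its squared norm is exactly the
  -- amount discarded.
  have hsq := integral_norm_sq_eq_realPairing hθ hθ.euler
    (shiftedOp α τ P + ((-l : ℝ) : ℂ) • P) P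
  have hsq0 : 0 ≤ ∫ x, ‖θ (‖x‖ ^ 2) • (shiftedOp α τ P + ((-l : ℝ) : ℂ) • P).1 x +
      eulerProfile θ (‖x‖ ^ 2) • P.1 x‖ ^ 2 := integral_nonneg fun x => sq_nonneg _
  rw [hsq] at hsq0
  simp only [realPairing_add_left (hθ.mul hθ), realPairing_add_right (hθ.mul hθ),
    realPairing_add_left (hθ.mul hθ.euler), realPairing_smul_left, realPairing_smul_right] at hsq0
  have hE := realPairing_euler hθ P
  -- The real part of `⟨v, (l + E + n/2)v⟩` is `l ‖v‖²`, the skew part contributing nothing.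
  have hcross : realPairing (fun t => θ t * θ t) P (shiftedOp α τ P) +
      realPairing (fun t => θ t * eulerProfile θ t) P P =
      l * realPairing (fun t => θ t * θ t) P P := by
    rw [shiftedOp_eq τ hP, realPairing_add_right (hθ.mul hθ), realPairing_smul_right, hl]
    linarith
  have hcl := mul_le_mul_of_nonneg_right hc hnn
  rw [realPairing_comm (fun t => θ t * θ t) (shiftedOp α τ P) P] at hsq0
  rw [hardyForm, realPairing_comm (fun t => θ t * eulerProfile θ t) P (shiftedOp α τ P)]
  have hcross' := congrArg (fun z => l * z) hcross
  linarith

/-- `E` commutes with `Γ`, so the shifted operator preserves each eigenspace and every term of the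
form pairs orthogonal eigenspaces. -/
theorem hardyForm_eq_zero {α : Fin n → Matrix (Fin m) (Fin m) ℂ} (hα : IsCliffordFamily α)
    (τ c : ℝ) {θ : ℝ → ℝ} (hθ : IsProfile θ) {μ ν : ℤ} (hne : μ ≠ ν) {P Q : Smooth n m}
    (hP : P ∈ gammaEigenspace α μ) (hQ : Q ∈ gammaEigenspace α ν) :
    hardyForm α τ c θ P Q = 0 := by
  have hmem : ∀ {μ : ℤ} {P : Smooth n m}, P ∈ gammaEigenspace α μ →
      shiftedOp α τ P ∈ gammaEigenspace α μ := fun h => by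
    rw [shiftedOp_eq τ h]
    exact Submodule.add_mem _ (euler_mem_gammaEigenspace hα h) (Submodule.smul_mem _ _ h)
  have hz : ∀ {ψ : ℝ → ℝ} {P Q : Smooth n m}, IsProfile ψ → P ∈ gammaEigenspace α μ →
      Q ∈ gammaEigenspace α ν → realPairing ψ P Q = 0 := fun hψ hP hQ => by
    rw [realPairing, pairing_eq_zero hα hψ hne hP hQ, Complex.zero_re]
  rw [hardyForm, hz (hθ.mul hθ) (hmem hP) (hmem hQ), hz (hθ.mul hθ.euler) (hmem hP) hQ,
    hz (hθ.mul hθ.euler) hP (hmem hQ), hz (hθ.euler.mul hθ.euler) hP hQ, hz (hθ.mul hθ) hP hQ]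
  ring

/-- The Hardy inequality for finite sums of homogeneous fields with a radial cutoff. -/
theorem hardy_homogeneousSum {α : Fin n → Matrix (Fin m) (Fin m) ℂ} (hα : IsCliffordFamily α)
    (hn : 0 < n) {τ c : ℝ} (hc : ∀ μ : ℤ, c ≤ (μ - (τ + n) / 2) ^ 2) {θ : ℝ → ℝ}
    (hθ : IsProfile θ) {P : Smooth n m} (hP : P ∈ homogeneousSum n m) :
    c * ∫ x, ‖θ (‖x‖ ^ 2) • P.1 x‖ ^ 2 ≤
      ∫ x, ‖θ (‖x‖ ^ 2) • (cliffordMul α x ((diracOp α P).1 x) - (τ / 2) • P.1 x) +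
        eulerProfile θ (‖x‖ ^ 2) • P.1 x‖ ^ 2 := by
  obtain ⟨f, hf, hsum⟩ := (Submodule.mem_iSup_iff_exists_finsupp _ _).1
    (homogeneousSum_le_iSup hα hn hP)
  have hform : 0 ≤ hardyForm α τ c θ P P := by
    rw [← hsum, Finsupp.sum, hardyForm_sum α τ c hθ]
    refine Finset.sum_nonneg fun i hi => ?_
    rw [Finset.sum_eq_single_of_mem i hi fun j _ hj =>
      hardyForm_eq_zero hα τ c hθ hj.symm (hf i) (hf j)]
    exact hardyForm_self_nonneg_of_mem α hθ (hc i) (hf i)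
  have h1 := integral_norm_sq_eq_realPairing hθ hθ.euler (shiftedOp α τ P) P
  have h2 : ∫ x, ‖θ (‖x‖ ^ 2) • P.1 x‖ ^ 2 = realPairing (fun t => θ t * θ t) P P := by
    rw [realPairing_eq_integral (hθ.mul hθ)]
    congr 1; funext x
    have hr : (inner ℂ (P.1 x) (P.1 x)).re = ‖P.1 x‖ ^ 2 := inner_self_eq_norm_sq (𝕜 := ℂ) (P.1 x)
    rw [hr, norm_smul, mul_pow, Real.norm_eq_abs, sq_abs, sq]
  have h3 : ∀ x, (shiftedOp α τ P).1 x =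
      cliffordMul α x ((diracOp α P).1 x) - (τ / 2) • P.1 x := by
    intro x
    rw [← positionOp_apply, shiftedOp, LinearMap.sub_apply, Smooth.val_sub, LinearMap.smul_apply,
      Smooth.val_smul, Pi.sub_apply, Pi.smul_apply, Complex.coe_smul]
    rfl
  simp only [← h3]
  rw [h1, h2]
  rw [hardyForm, realPairing_comm (fun t => θ t * eulerProfile θ t) P (shiftedOp α τ P)] at hform
  linarith

/-! ### Mollification in `L²` -/

section Mollification

open scoped ENNReal Convolution

variable {E : Type*} [NormedAddCommGroup E] [NormedSpace ℝ E]

/-- Cauchy–Schwarz after splitting `ab = a^{1/2} · (a^{1/2} b)`; applied with `a` a kernel of total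
mass one. -/
theorem sq_lintegral_mul_le {Ω : Type*} [MeasurableSpace Ω] (μ : Measure Ω) {a b : Ω → ℝ≥0∞}
    (ha : AEMeasurable a μ) (hb : AEMeasurable b μ) :
    (∫⁻ x, a x * b x ∂μ) ^ (2 : ℝ) ≤ (∫⁻ x, a x ∂μ) * ∫⁻ x, a x * b x ^ (2 : ℝ) ∂μ := by
  have hs : ∀ c : ℝ≥0∞, (c ^ (1 / 2 : ℝ)) ^ (2 : ℝ) = c := fun c => by
    rw [← ENNReal.rpow_mul]; norm_num
  have hsplit : ∀ x, a x * b x = a x ^ (1 / 2 : ℝ) * (a x ^ (1 / 2 : ℝ) * b x) := fun x => by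
    rw [← mul_assoc, ← sq, ← ENNReal.rpow_two, hs]
  have h := ENNReal.lintegral_mul_le_Lp_mul_Lq μ Real.HolderConjugate.two_two
    (f := fun x => a x ^ (1 / 2 : ℝ)) (g := fun x => a x ^ (1 / 2 : ℝ) * b x)
    (ha.pow_const _) ((ha.pow_const _).mul hb)
  simp only [Pi.mul_apply, ← hsplit, ENNReal.mul_rpow_of_nonneg _ _ zero_le_two, hs] at h
  refine (ENNReal.rpow_le_rpow h zero_le_two).trans_eq ?_
  rw [ENNReal.mul_rpow_of_nonneg _ _ zero_le_two, hs, hs]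

/-- Young's inequality for the convolution of an `L²` function with a mollifier. -/
theorem eLpNorm_normed_convolution_le (φ : ContDiffBump (0 : Dom n)) {v : Dom n → E}
    (hv : AEStronglyMeasurable v) :
    eLpNorm (φ.normed volume ⋆[ContinuousLinearMap.lsmul ℝ ℝ, volume] v) 2 volume ≤
      eLpNorm v 2 volume := by
  set k : Dom n → ℝ := φ.normed volume
  have hk : Continuous k := φ.continuous_normed
  have hk1 : ∫⁻ y, ‖k y‖ₑ = 1 := by
    rw [← ofReal_integral_norm_eq_lintegral_enorm φ.integrable_normed]
    have : ∫ y, ‖k y‖ = ∫ y, k y := by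
      congr 1; funext y
      exact Real.norm_of_nonneg (φ.nonneg_normed y)
    rw [this, φ.integral_normed, ENNReal.ofReal_one]
  rw [eLpNorm_eq_lintegral_rpow_enorm_toReal two_ne_zero ENNReal.ofNat_ne_top,
    eLpNorm_eq_lintegral_rpow_enorm_toReal two_ne_zero ENNReal.ofNat_ne_top]
  simp only [ENNReal.toReal_ofNat]
  refine ENNReal.rpow_le_rpow ?_ (by norm_num)
  have hmeas : AEMeasurable (Function.uncurry fun x y : Dom n =>
      ‖k (x - y)‖ₑ * ‖v y‖ₑ ^ (2 : ℝ)) (volume.prod volume) := by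
    refine AEMeasurable.mul ?_ ?_
    · exact (hk.comp (continuous_fst.sub continuous_snd)).enorm.measurable.aemeasurable
    · exact (hv.enorm.pow_const 2).comp_quasiMeasurePreserving
        Measure.quasiMeasurePreserving_snd
  calc ∫⁻ x, ‖(k ⋆[ContinuousLinearMap.lsmul ℝ ℝ, volume] v) x‖ₑ ^ (2 : ℝ)
      ≤ ∫⁻ x, ∫⁻ y, ‖k (x - y)‖ₑ * ‖v y‖ₑ ^ (2 : ℝ) := by
        refine lintegral_mono fun x => ?_
        have hkx : Continuous fun y => k (x - y) := hk.comp (continuous_const.sub continuous_id)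
        have h1 : ‖(k ⋆[ContinuousLinearMap.lsmul ℝ ℝ, volume] v) x‖ₑ ≤
            ∫⁻ y, ‖k (x - y)‖ₑ * ‖v y‖ₑ := by
          rw [convolution_lsmul_swap]
          refine (enorm_integral_le_lintegral_enorm _).trans_eq ?_
          simp only [enorm_smul]
        refine (ENNReal.rpow_le_rpow h1 zero_le_two).trans ?_
        refine (sq_lintegral_mul_le volume hkx.enorm.measurable.aemeasurable hv.enorm).trans_eq ?_
        rw [lintegral_sub_left_eq_self (fun y => ‖k y‖ₑ) x, hk1, one_mul]
    _ = ∫⁻ y, ∫⁻ x, ‖k (x - y)‖ₑ * ‖v y‖ₑ ^ (2 : ℝ) := lintegral_lintegral_swap hmeas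
    _ = ∫⁻ y, ‖v y‖ₑ ^ (2 : ℝ) := by
        refine lintegral_congr fun y => ?_
        have hky : Continuous fun x => k (x - y) := hk.comp (continuous_id.sub continuous_const)
        rw [lintegral_mul_const _ hky.enorm.measurable,
          lintegral_sub_right_eq_self (fun y => ‖k y‖ₑ) y, hk1, one_mul]

/-- Mollifications converge in `L²` on balls. -/
theorem exists_eLpNorm_normed_convolution_sub_le [CompleteSpace E] {v : Dom n → E}
    (hv : MemLp v 2) (R : ℝ) {η : ℝ≥0∞} (hη : η ≠ 0) :
    ∃ δ > 0, ∀ φ : ContDiffBump (0 : Dom n), φ.rOut < δ →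
      eLpNorm (φ.normed volume ⋆[ContinuousLinearMap.lsmul ℝ ℝ, volume] v - v) 2
        (volume.restrict (Metric.closedBall 0 R)) ≤ η := by
  have hη3 : η / 3 ≠ 0 := (ENNReal.div_pos hη (by norm_num)).ne'
  obtain ⟨g, hgs, hg, hgc, hgm⟩ := hv.exists_hasCompactSupport_eLpNorm_sub_le
    (by norm_num : (2 : ℝ≥0∞) ≠ ⊤) hη3
  set B : Set (Dom n) := Metric.closedBall 0 R
  have hB : volume B < ⊤ := (isCompact_closedBall 0 R).measure_lt_top
  obtain ⟨ε, hε, hεη⟩ : ∃ ε : ℝ, 0 < ε ∧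
      volume B ^ (2 : ℝ)⁻¹ * ENNReal.ofReal ε ≤ η / 3 := by
    rcases eq_or_ne (η / 3) ⊤ with h | h
    · exact ⟨1, one_pos, h ▸ le_top⟩
    have hM : volume B ^ (2 : ℝ)⁻¹ ≠ ⊤ := (ENNReal.rpow_lt_top_of_nonneg (by norm_num) hB.ne).ne
    set M := volume B ^ (2 : ℝ)⁻¹
    refine ⟨(η / 3 / (M + 1)).toReal, ENNReal.toReal_pos
      (ENNReal.div_pos hη3 (by finiteness)).ne' (ENNReal.div_lt_top h (by simp)).ne, ?_⟩
    rw [ENNReal.ofReal_toReal (ENNReal.div_lt_top h (by simp)).ne]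
    refine (mul_le_mul_left (le_self_add : M ≤ M + 1) _).trans ?_
    exact ENNReal.mul_div_le
  obtain ⟨δ, hδ, hgδ⟩ := Metric.uniformContinuous_iff.1
    (hgs.uniformContinuous_of_continuous hgc) ε hε
  refine ⟨δ, hδ, fun φ hφ => ?_⟩
  set k : Dom n → ℝ := φ.normed volume
  have hk : Continuous k := φ.continuous_normed
  have hks : HasCompactSupport k := φ.hasCompactSupport_normed
  have hvg : LocallyIntegrable (v - g) := (hv.sub hgm).locallyIntegrable one_le_two
  have hgl : LocallyIntegrable g := hgm.locallyIntegrable one_le_two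
  have hc1 : Continuous (k ⋆[ContinuousLinearMap.lsmul ℝ ℝ, volume] (v - g)) :=
    hks.continuous_convolution_left _ hk hvg
  have hc2 : Continuous (k ⋆[ContinuousLinearMap.lsmul ℝ ℝ, volume] g) :=
    hks.continuous_convolution_left _ hk hgl
  -- The three thirds of `η`: Young's inequality for `v - g`, uniform continuity of `g` on a ball of
  -- finite volume, and `g ≈ v` itself.
  have hdec : k ⋆[ContinuousLinearMap.lsmul ℝ ℝ, volume] v - v =
      k ⋆[ContinuousLinearMap.lsmul ℝ ℝ, volume] (v - g) +
        (k ⋆[ContinuousLinearMap.lsmul ℝ ℝ, volume] g - g) - (v - g) := by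
    have h := (hks.convolutionExists_left (ContinuousLinearMap.lsmul ℝ ℝ) hk hvg).distrib_add
      (hks.convolutionExists_left (ContinuousLinearMap.lsmul ℝ ℝ) hk hgl)
    rw [sub_add_cancel] at h
    rw [h]; abel
  have hm1 := hc1.aestronglyMeasurable (μ := volume.restrict B)
  have hm2 := (hc2.sub hgc).aestronglyMeasurable (μ := volume.restrict B)
  have hm3 := (hv.sub hgm).aestronglyMeasurable.restrict (s := B)
  rw [hdec]
  calc _ ≤ _ := eLpNorm_sub_le (hm1.add hm2) hm3 one_le_two
    _ ≤ η / 3 + η / 3 + η / 3 := by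
        refine add_le_add ((eLpNorm_add_le hm1 hm2 one_le_two).trans (add_le_add ?_ ?_)) ?_
        · exact (eLpNorm_mono_measure _ Measure.restrict_le_self).trans
            ((eLpNorm_normed_convolution_le φ (hv.sub hgm).aestronglyMeasurable).trans hg)
        · refine (eLpNorm_le_of_ae_bound (C := ε) (Filter.Eventually.of_forall fun x => ?_)).trans
            ?_
          · rw [Pi.sub_apply, ← dist_eq_norm]
            refine φ.dist_normed_convolution_le hgc.aestronglyMeasurable fun y hy => ?_
            exact (hgδ ((Metric.mem_ball.1 hy).trans hφ)).le
          · simpa using hεη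
        · exact (eLpNorm_mono_measure _ Measure.restrict_le_self).trans hg
    _ = η := ENNReal.add_thirds η

end Mollification

/-! ### Polynomials and their density on balls -/

section Polynomial

/-- Evaluation of a real polynomial at a point of `ℝⁿ`. -/
noncomputable def polyEval (p : MvPolynomial (Fin n) ℝ) (x : Dom n) : ℝ :=
  MvPolynomial.eval (fun i => x i) p

theorem polyEval_C (a : ℝ) : polyEval (MvPolynomial.C a) = fun _ : Dom n => a := by
  funext y; simp [polyEval]

theorem polyEval_add (p q : MvPolynomial (Fin n) ℝ) :
    polyEval (p + q) = fun y => polyEval p y + polyEval q y := by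
  funext y; simp [polyEval]

theorem polyEval_mul_X (p : MvPolynomial (Fin n) ℝ) (i : Fin n) :
    polyEval (p * MvPolynomial.X i) = fun y => polyEval p y * y i := by
  funext y; simp [polyEval]

theorem polyEval_pderiv_mul_X (p : MvPolynomial (Fin n) ℝ) (i j : Fin n) (y : Dom n) :
    polyEval (MvPolynomial.pderiv j (p * MvPolynomial.X i)) y =
      polyEval (MvPolynomial.pderiv j p) y * y i + if i = j then polyEval p y else 0 := by
  rw [Derivation.leibniz, add_comm, MvPolynomial.pderiv_X]
  by_cases h : i = j
  · subst h; simp [polyEval, mul_comm]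
  · simp [polyEval, h, mul_comm]

theorem contDiff_polyEval (p : MvPolynomial (Fin n) ℝ) : ContDiff ℝ ∞ (polyEval p) := by
  induction p using MvPolynomial.induction_on with
  | C a => rw [polyEval_C]; exact contDiff_const
  | add p q hp hq => rw [polyEval_add]; exact hp.add hq
  | mul_X p i hp =>
    have h : ContDiff ℝ ∞ fun x : Dom n => x i := by fun_prop
    rw [polyEval_mul_X]; exact hp.mul h

theorem fderiv_polyEval_single (p : MvPolynomial (Fin n) ℝ) (x : Dom n) (j : Fin n) :
    fderiv ℝ (polyEval p) x (EuclideanSpace.single j 1) =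
      polyEval (MvPolynomial.pderiv j p) x := by
  have hd : ∀ p : MvPolynomial (Fin n) ℝ, HasFDerivAt (polyEval p) (fderiv ℝ (polyEval p) x) x :=
    fun p => ((contDiff_polyEval p).differentiable (by simp) x).hasFDerivAt
  induction p using MvPolynomial.induction_on with
  | C a => rw [polyEval_C]; simp [polyEval]
  | add p q hp hq =>
    rw [polyEval_add, ((hd p).fun_add (hd q)).fderiv, map_add, polyEval_add,
      add_apply, hp, hq]
  | mul_X p i hp =>
    rw [polyEval_mul_X, ((hd p).fun_mul (hasFDerivAt_coord i x)).fderiv, polyEval_pderiv_mul_X]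
    by_cases h : i = j
    · subst h; simp [hp]; ring
    · simp [hp, h]; ring

/-- Polynomials are uniformly dense in the continuous functions on a ball. -/
theorem exists_polyEval_near {k : Dom n → ℝ} (hk : Continuous k) (R : ℝ) {ε : ℝ} (hε : 0 < ε) :
    ∃ p : MvPolynomial (Fin n) ℝ, ∀ x ∈ Metric.closedBall (0 : Dom n) R,
      ‖polyEval p x - k x‖ < ε := by
  let F : MvPolynomial (Fin n) ℝ →ₐ[ℝ] C(Dom n, ℝ) :=
    MvPolynomial.aeval fun i => ⟨fun x : Dom n => x i, by fun_prop⟩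
  have hF : ∀ p x, F p x = polyEval p x := by
    intro p x
    induction p using MvPolynomial.induction_on with
    | C a => simp [F, polyEval]
    | add p q hp hq => simp only [map_add, ContinuousMap.add_apply, hp, hq]; simp [polyEval]
    | mul_X p i hp =>
      simp only [map_mul, ContinuousMap.mul_apply, hp]; simp [F, polyEval]
  have hsep : F.range.SeparatesPoints := by
    intro x y hxy
    obtain ⟨i, hi⟩ : ∃ i, x i ≠ y i := by
      by_contra h
      push Not at h
      exact hxy (PiLp.ext h)
    exact ⟨F (MvPolynomial.X i), ⟨_, ⟨_, rfl⟩, rfl⟩, by simpa [F] using hi⟩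
  obtain ⟨_, ⟨p, rfl⟩, hp⟩ :=
    ContinuousMap.exists_mem_subalgebra_near_continuous_of_isCompact_of_separatesPoints hsep
      ⟨k, hk⟩ (isCompact_closedBall (0 : Dom n) R) hε
  refine ⟨p, fun x hx => ?_⟩
  rw [← hF]
  exact hp x hx

end Polynomial

/-! ### Convolution with polynomial kernels -/

section Convolution

open scoped ENNReal Convolution

variable {E : Type*} [NormedAddCommGroup E] [NormedSpace ℝ E]

theorem integrable_continuous_smul {c : Dom n → ℝ} (hc : Continuous c) {v : Dom n → E} {R : ℝ}
    (hv : Integrable v) (hz : ∀ᵐ y, y ∉ Metric.closedBall 0 R → v y = 0) :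
    Integrable fun y => c y • v y :=
  (hv.integrableOn.continuousOn_smul hc.continuousOn
    (isCompact_closedBall 0 R)).integrable_of_ae_notMem_eq_zero
    (hz.mono fun y h hy => by simp [h hy])

theorem integrable_of_memLp_two {E : Type*} [NormedAddCommGroup E] {v : Dom n → E} {R : ℝ} (hv : MemLp v 2)
    (hz : ∀ᵐ y, y ∉ Metric.closedBall 0 R → v y = 0) : Integrable v :=
  IntegrableOn.integrable_of_ae_notMem_eq_zero
    (hv.locallyIntegrable one_le_two |>.integrableOn_isCompact (isCompact_closedBall 0 R)) hz

/-- The convolution of `v` with a polynomial. -/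
noncomputable def polyConv (p : MvPolynomial (Fin n) ℝ) (v : Dom n → E) (x : Dom n) : E :=
  ∫ y, polyEval p (x - y) • v y

theorem integrable_polyConv (p : MvPolynomial (Fin n) ℝ) {v : Dom n → E} {R : ℝ}
    (hv : Integrable v) (hz : ∀ᵐ y, y ∉ Metric.closedBall 0 R → v y = 0) (x : Dom n) :
    Integrable fun y => polyEval p (x - y) • v y :=
  integrable_continuous_smul
    ((contDiff_polyEval p).continuous.comp (continuous_const.sub continuous_id)) hv hz

/-- Polynomial convolution kernels approximating a mollifier uniformly do so in `L²`. -/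
theorem eLpNorm_polyConv_sub_le (p : MvPolynomial (Fin n) ℝ) (φ : ContDiffBump (0 : Dom n))
    {v : Dom n → E} {R ε : ℝ} (hv : Integrable v)
    (hz : ∀ᵐ y, y ∉ Metric.closedBall 0 R → v y = 0)
    (hp : ∀ x ∈ Metric.closedBall (0 : Dom n) (2 * R),
      ‖polyEval p x - φ.normed volume x‖ ≤ ε) :
    eLpNorm (polyConv p v - φ.normed volume ⋆[ContinuousLinearMap.lsmul ℝ ℝ, volume] v) 2
      (volume.restrict (Metric.closedBall 0 R)) ≤
      volume (Metric.closedBall (0 : Dom n) R) ^ (2 : ℝ)⁻¹ *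
        ENNReal.ofReal (ε * ∫ y, ‖v y‖) := by
  have hb : ∀ x ∈ Metric.closedBall (0 : Dom n) R,
      ‖(polyConv p v - φ.normed volume ⋆[ContinuousLinearMap.lsmul ℝ ℝ, volume] v) x‖ ≤
        ε * ∫ y, ‖v y‖ := by
    intro x hx
    have hk : Integrable fun y => φ.normed volume (x - y) • v y :=
      integrable_continuous_smul
        (φ.continuous_normed.comp (continuous_const.sub continuous_id)) hv hz
    rw [Pi.sub_apply, convolution_lsmul_swap, polyConv,
      ← integral_sub (integrable_polyConv p hv hz x) hk, ← integral_const_mul]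
    refine norm_integral_le_of_norm_le (hv.norm.const_mul ε) (hz.mono fun y hy => ?_)
    by_cases hyB : y ∈ Metric.closedBall 0 R
    · rw [← sub_smul, norm_smul]
      refine mul_le_mul_of_nonneg_right (hp _ ?_) (norm_nonneg _)
      -- With `x` and `y` in the ball of radius `R`, the difference `x - y` lies in that of radius
      -- `2R`, where the kernels are compared.
      rw [mem_closedBall_zero_iff] at hx hyB ⊢
      linarith [norm_sub_le x y]
    · simp [hy hyB]
  have h := eLpNorm_le_of_ae_bound (p := 2) (μ := volume.restrict (Metric.closedBall 0 R))
    ((ae_restrict_iff' Metric.isClosed_closedBall.measurableSet).2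
      (Filter.Eventually.of_forall hb))
  simpa using h

/-- A single kernel has to serve two functions at once: it will be applied to `u` and to its weak
Dirac derivative. -/
theorem exists_polyConv_near [CompleteSpace E] {v w : Dom n → E} {R : ℝ} (hv : MemLp v 2)
    (hw : MemLp w 2) (hvz : ∀ᵐ y, y ∉ Metric.closedBall 0 R → v y = 0)
    (hwz : ∀ᵐ y, y ∉ Metric.closedBall 0 R → w y = 0) {η : ℝ≥0∞} (hη : η ≠ 0) :
    ∃ p : MvPolynomial (Fin n) ℝ,
      eLpNorm (polyConv p v - v) 2 (volume.restrict (Metric.closedBall 0 R)) ≤ η ∧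
      eLpNorm (polyConv p w - w) 2 (volume.restrict (Metric.closedBall 0 R)) ≤ η := by
  have hη2 : η / 2 ≠ 0 := (ENNReal.div_pos hη (by norm_num)).ne'
  have hvi := integrable_of_memLp_two hv hvz
  have hwi := integrable_of_memLp_two hw hwz
  obtain ⟨δ₁, hδ₁, h₁⟩ := exists_eLpNorm_normed_convolution_sub_le hv R hη2
  obtain ⟨δ₂, hδ₂, h₂⟩ := exists_eLpNorm_normed_convolution_sub_le hw R hη2
  have hδ : 0 < min δ₁ δ₂ := lt_min hδ₁ hδ₂
  let φ : ContDiffBump (0 : Dom n) :=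
    ⟨min δ₁ δ₂ / 4, min δ₁ δ₂ / 2, by positivity, by linarith⟩
  have hφ : φ.rOut < min δ₁ δ₂ := by
    change min δ₁ δ₂ / 2 < _
    linarith
  have hφ₁ := h₁ φ (hφ.trans_le (min_le_left _ _))
  have hφ₂ := h₂ φ (hφ.trans_le (min_le_right _ _))
  set B : Set (Dom n) := Metric.closedBall 0 R
  have hB : volume B ≠ ⊤ := (isCompact_closedBall 0 R).measure_lt_top.ne
  set N : ℝ := (∫ y, ‖v y‖) + ∫ y, ‖w y‖
  obtain ⟨ε, hε, hεη⟩ : ∃ ε : ℝ, 0 < ε ∧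
      volume B ^ (2 : ℝ)⁻¹ * ENNReal.ofReal (ε * N) ≤ η / 2 := by
    have ht : Filter.Tendsto (fun ε : ℝ => volume B ^ (2 : ℝ)⁻¹ * ENNReal.ofReal (ε * N))
        (nhdsWithin 0 (Set.Ioi 0)) (nhds 0) := by
      have h1 : Filter.Tendsto (fun ε : ℝ => ε * N) (nhdsWithin 0 (Set.Ioi 0)) (nhds 0) := by
        have : Continuous fun ε : ℝ => ε * N := by fun_prop
        simpa using (this.tendsto 0).mono_left nhdsWithin_le_nhds
      have h2 := ENNReal.Tendsto.const_mul (a := volume B ^ (2 : ℝ)⁻¹)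
        (ENNReal.tendsto_ofReal h1)
        (Or.inr (ENNReal.rpow_lt_top_of_nonneg (by norm_num) hB).ne)
      simpa using h2
    have he := ht.eventually (ge_mem_nhds (pos_iff_ne_zero.2 hη2))
    obtain ⟨ε, h1, h2⟩ := (he.and self_mem_nhdsWithin).exists
    exact ⟨ε, h2, h1⟩
  obtain ⟨p, hp⟩ := exists_polyEval_near
    (φ.continuous_normed (μ := (volume : Measure (Dom n)))) (2 * R) hε
  have key : ∀ u : Dom n → E, MemLp u 2 → (∀ᵐ y, y ∉ B → u y = 0) → (∫ y, ‖u y‖) ≤ N →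
      eLpNorm (φ.normed volume ⋆[ContinuousLinearMap.lsmul ℝ ℝ, volume] u - u) 2
        (volume.restrict B) ≤ η / 2 →
      eLpNorm (polyConv p u - u) 2 (volume.restrict B) ≤ η := by
    intro u hu huz hN hun
    have hui := integrable_of_memLp_two hu huz
    have hcc : Continuous (φ.normed volume ⋆[ContinuousLinearMap.lsmul ℝ ℝ, volume] u) :=
      φ.hasCompactSupport_normed.continuous_convolution_left _ φ.continuous_normed
        (hu.locallyIntegrable one_le_two)
    have hmp : AEStronglyMeasurable (polyConv p u) volume := by
      have : AEStronglyMeasurable (Function.uncurry fun x y : Dom n =>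
          polyEval p (x - y) • u y) (volume.prod volume) :=
        ((contDiff_polyEval p).continuous.comp
          (continuous_fst.sub continuous_snd)).aestronglyMeasurable.smul
          hu.aestronglyMeasurable.comp_snd
      exact this.integral_prod_right'
    have e : polyConv p u - u =
        (polyConv p u - φ.normed volume ⋆[ContinuousLinearMap.lsmul ℝ ℝ, volume] u) +
          (φ.normed volume ⋆[ContinuousLinearMap.lsmul ℝ ℝ, volume] u - u) := by abel
    rw [e]
    refine (eLpNorm_add_le (hmp.sub hcc.aestronglyMeasurable).restrict
      (hcc.aestronglyMeasurable.sub hu.aestronglyMeasurable).restrict one_le_two).trans ?_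
    rw [← ENNReal.add_halves η]
    refine add_le_add ?_ hun
    refine (eLpNorm_polyConv_sub_le p φ hui huz fun x hx => (hp x hx).le).trans ?_
    refine le_trans ?_ hεη
    gcongr
  exact ⟨p, key v hv hvz (le_add_of_nonneg_right (integral_nonneg fun _ => norm_nonneg _)) hφ₁,
    key w hw hwz (le_add_of_nonneg_left (integral_nonneg fun _ => norm_nonneg _)) hφ₂⟩

end Convolution

/-- Convolutions with polynomials are polynomials. -/
theorem exists_homogeneousSum_polyConv (p : MvPolynomial (Fin n) ℝ) {v : Dom n → Spinor m} {R : ℝ}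
    (hv : Integrable v) (hz : ∀ᵐ y, y ∉ Metric.closedBall 0 R → v y = 0) :
    ∃ P ∈ homogeneousSum n m, (∀ x, P.1 x = polyConv p v x) ∧
      ∀ j x, (partialOp j P).1 x = polyConv (MvPolynomial.pderiv j p) v x := by
  -- The function must vary: as `(x - y)ᵢ = xᵢ - yᵢ`, a factor `Xᵢ` in the kernel gives `xᵢ (p * v)
  -- - p * (yᵢ v)`, which uses the hypothesis for `yᵢ v` too.
  induction p using MvPolynomial.induction_on generalizing v with
  | C a =>
    refine ⟨_, constField_mem_homogeneousSum (a • ∫ y, v y), fun x => ?_, fun j x => ?_⟩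
    · simp [polyConv, polyEval, constField, integral_smul]
    · rw [partialOp_apply]
      simp [polyConv, polyEval, constField]
  | add p q hp hq =>
    obtain ⟨P, hPm, hP, hP'⟩ := hp hv hz
    obtain ⟨Q, hQm, hQ, hQ'⟩ := hq hv hz
    have hadd : ∀ (p q : MvPolynomial (Fin n) ℝ) x,
        polyConv (p + q) v x = polyConv p v x + polyConv q v x := by
      intro p q x
      rw [polyConv, polyConv, polyConv, ← integral_add (integrable_polyConv p hv hz x)
        (integrable_polyConv q hv hz x)]
      simp only [polyEval_add, add_smul]
    refine ⟨P + Q, Submodule.add_mem _ hPm hQm, fun x => ?_, fun j x => ?_⟩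
    · rw [hadd, Smooth.val_add, Pi.add_apply, hP, hQ]
    · rw [map_add, map_add, hadd, Smooth.val_add, Pi.add_apply, hP', hQ']
  | mul_X p i hp =>
    have hci : Continuous fun y : Dom n => y i := by fun_prop
    have hvi : Integrable fun y => y i • v y := integrable_continuous_smul hci hv hz
    have hzi : ∀ᵐ y, y ∉ Metric.closedBall 0 R → y i • v y = 0 :=
      hz.mono fun y h hy => by simp [h hy]
    obtain ⟨P, hPm, hP, hP'⟩ := hp hv hz
    obtain ⟨Q, hQm, hQ, hQ'⟩ := hp hvi hzi
    have hmul : ∀ (q : MvPolynomial (Fin n) ℝ) (x : Dom n),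
        ∫ y, (polyEval q (x - y) * (x - y) i) • v y =
          x i • polyConv q v x - polyConv q (fun y => y i • v y) x := by
      intro q x
      have hs : Integrable fun y => x i • polyEval q (x - y) • v y :=
        (integrable_polyConv q hv hz x).smul (x i)
      rw [polyConv, polyConv, ← integral_smul, ← integral_sub hs (integrable_polyConv q hvi hzi x)]
      congr 1; funext y
      rw [smul_smul, smul_smul, ← sub_smul]
      congr 1
      rw [PiLp.sub_apply]; ring
    refine ⟨coordOp i P - Q, Submodule.sub_mem _ (coord_mem_homogeneousSum i hPm) hQm,
      fun x => ?_, fun j x => ?_⟩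
    · rw [Smooth.val_sub, Pi.sub_apply, coordOp_apply, hP, hQ, ← hmul, polyConv]
      simp only [polyEval_mul_X]
    · have e := ((hasFDerivAt_coord i x).smul (P.differentiable x).hasFDerivAt).fderiv
      have e' := congrArg (fun T => T (EuclideanSpace.single j 1)) e
      have e2 : (partialOp j (coordOp i P)).1 x = _ := e'
      have e3 : (partialOp j (coordOp i P)).1 x =
          x i • (partialOp j P).1 x + if i = j then P.1 x else 0 := by
        rw [e2]
        by_cases h : i = j
        · subst h; simp [partialOp_apply]
        · simp [partialOp_apply, h]
      rw [map_sub, Smooth.val_sub, Pi.sub_apply, e3, hP', hQ', hP]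
      change _ = ∫ y, polyEval _ (x - y) • v y
      have hint : Integrable fun y => (polyEval (MvPolynomial.pderiv j p) (x - y) *
          (x - y) i) • v y := by
        have h := integrable_polyConv (MvPolynomial.pderiv j p * MvPolynomial.X i) hv hz x
        simpa only [polyEval_mul_X] using h
      simp only [polyEval_pderiv_mul_X, add_smul]
      rw [integral_add hint, hmul]
      · by_cases h : i = j
        · simp only [h, if_true]
          change _ = _ + polyConv p v x
          abel
        · simp [h]
      · by_cases h : i = j
        · simpa only [h, if_true] using integrable_polyConv p hv hz x
        · simp [h]

/-! ### Weak derivatives under polynomial convolution -/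

theorem exists_contDiff_eq_one (R : ℝ) :
    ∃ χ : Dom n → ℝ, ContDiff ℝ ∞ χ ∧ HasCompactSupport χ ∧
      ∀ y ∈ Metric.closedBall (0 : Dom n) R, χ =ᶠ[nhds y] 1 := by
  let φ : ContDiffBump (0 : Dom n) := ⟨|R| + 1, |R| + 2, by positivity, by linarith⟩
  refine ⟨φ, φ.contDiff, φ.hasCompactSupport, fun y hy => ?_⟩
  refine φ.eventuallyEq_one_of_mem_ball ?_
  change y ∈ Metric.ball 0 (|R| + 1)
  rw [mem_ball_zero_iff]
  rw [mem_closedBall_zero_iff] at hy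
  linarith [le_abs_self R]

/-- Weak derivatives vanish wherever the function does. -/
theorem HasWeakPartialDeriv.ae_eq_zero {j : Fin n} {u g : Dom n → Spinor m}
    (h : HasWeakPartialDeriv j u g) {S : Set (Dom n)} (hS : IsClosed S)
    (hz : ∀ᵐ y, y ∉ S → u y = 0) : ∀ᵐ y, y ∉ S → g y = 0 := by
  refine IsOpen.ae_eq_zero_of_integral_contDiff_smul_eq_zero hS.isOpen_compl
    (h.locallyIntegrable_deriv.locallyIntegrableOn _) fun φ hφ hc hs => ?_
  rw [h.integral_eq φ hφ hc, neg_eq_zero]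
  refine integral_eq_zero_of_ae (hz.mono fun y hy => ?_)
  by_cases hyB : y ∈ S
  · have : y ∉ tsupport (fderiv ℝ φ) := fun hy' => hs (tsupport_fderiv_subset ℝ hy') hyB
    simp [image_eq_zero_of_notMem_tsupport this]
  · simp [hy hyB]

/-- The test function is `y ↦ χ(y) p(x - y)`, with `χ = 1` near the ball carrying `u`. The sign from
differentiating `p(x - y)` in `y` cancels the one in the weak derivative. -/
theorem HasWeakPartialDeriv.polyConv_pderiv {j : Fin n} {u g : Dom n → Spinor m}
    (h : HasWeakPartialDeriv j u g) {R : ℝ}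
    (hz : ∀ᵐ y, y ∉ Metric.closedBall 0 R → u y = 0) (p : MvPolynomial (Fin n) ℝ) (x : Dom n) :
    polyConv (MvPolynomial.pderiv j p) u x = polyConv p g x := by
  obtain ⟨χ, hχ, hχc, hχ1⟩ := exists_contDiff_eq_one (n := n) R
  have hp : ContDiff ℝ ∞ fun y => polyEval p (x - y) :=
    (contDiff_polyEval p).comp (contDiff_const.sub contDiff_id)
  have hw := h.integral_eq (fun y => χ y * polyEval p (x - y)) (hχ.mul hp) hχc.mul_right
  have e1 : ∫ y, (χ y * polyEval p (x - y)) • g y = polyConv p g x := by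
    refine integral_congr_ae ((h.ae_eq_zero Metric.isClosed_closedBall hz).mono fun y hy => ?_)
    by_cases hyB : y ∈ Metric.closedBall 0 R
    · simp only [(hχ1 y hyB).eq_of_nhds, Pi.one_apply, one_mul]
    · simp [hy hyB]
  have e2 : ∫ y, (fderiv ℝ (fun y => χ y * polyEval p (x - y)) y (EuclideanSpace.single j 1)) •
      u y = -polyConv (MvPolynomial.pderiv j p) u x := by
    rw [polyConv, ← integral_neg]
    refine integral_congr_ae (hz.mono fun y hy => ?_)
    by_cases hyB : y ∈ Metric.closedBall 0 R
    · have he : (fun y => χ y * polyEval p (x - y)) =ᶠ[nhds y] fun y => polyEval p (x - y) := by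
        filter_upwards [hχ1 y hyB] with z hz
        rw [hz, Pi.one_apply, one_mul]
      have hd : fderiv ℝ (fun y => polyEval p (x - y)) y = -fderiv ℝ (polyEval p) (x - y) :=
        (((contDiff_polyEval p).differentiable (by simp) (x - y)).hasFDerivAt.comp y
          ((hasFDerivAt_id y).const_sub x)).fderiv.trans (by ext; simp)
      simp only [he.fderiv_eq, hd, neg_apply, fderiv_polyEval_single, neg_smul]
    · simp [hy hyB]
  rw [e1, e2, neg_neg] at hw
  exact hw.symm

/-! ### Passage to the limit for Sobolev functions -/

section Limit

open scoped ENNReal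

theorem integrable_norm_sq_of_memLp {E : Type*} [NormedAddCommGroup E] {f : Dom n → E}
    (hf : MemLp f 2) : Integrable fun x => ‖f x‖ ^ 2 := by
  simpa using hf.integrable_norm_pow (p := 2) two_ne_zero

theorem eLpNorm_two_sq {E : Type*} [NormedAddCommGroup E] {f : Dom n → E} (hf : MemLp f 2) :
    eLpNorm f 2 volume ^ 2 = ENNReal.ofReal (∫ x, ‖f x‖ ^ 2) := by
  have h := eLpNorm_nnreal_pow_eq_lintegral (μ := (volume : Measure (Dom n))) (f := f)
    (p := 2) two_ne_zero
  rw [ofReal_integral_eq_lintegral_ofReal (integrable_norm_sq_of_memLp hf)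
    (Filter.Eventually.of_forall fun x => sq_nonneg _)]
  simp only [NNReal.coe_ofNat, ENNReal.rpow_ofNat, ENNReal.coe_ofNat] at h
  rw [h]
  refine lintegral_congr fun x => ?_
  rw [ENNReal.ofReal_pow (norm_nonneg _), ofReal_norm]

theorem mul_eLpNorm_two_le_iff {E : Type*} [NormedAddCommGroup E] {f g : Dom n → E} {c : ℝ}
    (hc : 0 ≤ c) (hf : MemLp f 2) (hg : MemLp g 2) :
    ENNReal.ofReal c * eLpNorm f 2 volume ≤ eLpNorm g 2 volume ↔
      c ^ 2 * ∫ x, ‖f x‖ ^ 2 ≤ ∫ x, ‖g x‖ ^ 2 := by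
  rw [← ENNReal.pow_le_pow_left_iff (two_ne_zero), mul_pow, eLpNorm_two_sq hf, eLpNorm_two_sq hg,
    ← ENNReal.ofReal_pow hc, ← ENNReal.ofReal_mul (sq_nonneg c),
    ENNReal.ofReal_le_ofReal_iff (integral_nonneg fun _ => sq_nonneg _)]

theorem eLpNorm_le_of_bound_on {E F : Type*} [NormedAddCommGroup E] [NormedAddCommGroup F]
    {W : Dom n → E} {w : Dom n → F} {S : Set (Dom n)} (hS : MeasurableSet S) {M : ℝ}
    (hb : ∀ x ∈ S, ‖W x‖ ≤ M * ‖w x‖) (h0 : ∀ x, x ∉ S → W x = 0) :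
    eLpNorm W 2 volume ≤ ENNReal.ofReal M * eLpNorm w 2 (volume.restrict S) := by
  have e : W = S.indicator W := by
    funext x
    by_cases hx : x ∈ S
    · rw [Set.indicator_of_mem hx]
    · rw [Set.indicator_of_notMem hx, h0 x hx]
  rw [e, eLpNorm_indicator_eq_eLpNorm_restrict hS]
  exact eLpNorm_le_mul_eLpNorm_of_ae_le_mul
    ((ae_restrict_iff' hS).2 (Filter.Eventually.of_forall hb)) 2

theorem aestronglyMeasurable_cliffordMul (α : Fin n → Matrix (Fin m) (Fin m) ℂ)
    {f : Dom n → Spinor m} (hf : AEStronglyMeasurable f) :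
    AEStronglyMeasurable fun x => cliffordMul α x (f x) := by
  simp only [cliffordMul, LinearMap.sum_apply, LinearMap.smul_apply]
  refine Finset.aestronglyMeasurable_fun_sum _ fun j _ => ?_
  have hc : Continuous fun x : Dom n => (x j : ℂ) := by fun_prop
  exact hc.aestronglyMeasurable.smul
    ((α j).toEuclideanLin.toContinuousLinearMap.continuous.comp_aestronglyMeasurable hf)

/-- The operator `∑ⱼ αⱼ ∂ⱼ` in the weak sense. -/
noncomputable def weakDirac (α : Fin n → Matrix (Fin m) (Fin m) ℂ) (u : Dom n → Spinor m)
    (x : Dom n) : Spinor m :=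
  ∑ j, (α j).toEuclideanLin (weakPartialDeriv j u x)

theorem masslessDirac_eq (α : Fin n → Matrix (Fin m) (Fin m) ℂ) (u : Dom n → Spinor m)
    (x : Dom n) : masslessDirac α u x = (-Complex.I) • weakDirac α u x := by
  simp only [masslessDirac, weakDirac, map_smul, Finset.smul_sum]

theorem norm_masslessDirac (α : Fin n → Matrix (Fin m) (Fin m) ℂ) (u : Dom n → Spinor m)
    (x : Dom n) : ‖masslessDirac α u x‖ = ‖weakDirac α u x‖ := by
  rw [masslessDirac_eq, norm_smul, norm_neg, Complex.norm_I, one_mul]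

theorem MemW12.hasWeakPartialDeriv {u : Dom n → Spinor m} (hu : MemW12 u) (j : Fin n) :
    HasWeakPartialDeriv j u (weakPartialDeriv j u) := by
  obtain ⟨g, hg, -⟩ := hu.2 j
  have hex : ∃ g, HasWeakPartialDeriv j u g := ⟨g, hg⟩
  rw [weakPartialDeriv, dif_pos hex]
  exact hex.choose_spec

theorem MemW12.memLp_weakPartialDeriv {u : Dom n → Spinor m} (hu : MemW12 u) (j : Fin n) :
    MemLp (weakPartialDeriv j u) 2 := by
  obtain ⟨g, hg, hg2⟩ := hu.2 j
  exact hg2.ae_eq hg.weakPartialDeriv_ae_eq.symm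

theorem MemW12.memLp_weakDirac (α : Fin n → Matrix (Fin m) (Fin m) ℂ) {u : Dom n → Spinor m}
    (hu : MemW12 u) : MemLp (weakDirac α u) 2 :=
  memLp_finsetSum _ fun j _ =>
    (α j).toEuclideanLin.toContinuousLinearMap.comp_memLp' (hu.memLp_weakPartialDeriv j)

theorem MemW12.weakDirac_ae_eq_zero (α : Fin n → Matrix (Fin m) (Fin m) ℂ)
    {u : Dom n → Spinor m} (hu : MemW12 u) {S : Set (Dom n)} (hS : IsClosed S)
    (hz : ∀ᵐ y, y ∉ S → u y = 0) : ∀ᵐ y, y ∉ S → weakDirac α u y = 0 := by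
  have h := ae_all_iff.2 fun j => (hu.hasWeakPartialDeriv j).ae_eq_zero hS hz
  filter_upwards [h] with y hy hyS
  simp [weakDirac, hy _ hyS]

/-- Convolution with a polynomial commutes with the Dirac operator. -/
theorem MemW12.exists_homogeneousSum_polyConv (α : Fin n → Matrix (Fin m) (Fin m) ℂ)
    {u : Dom n → Spinor m} (hu : MemW12 u) {R : ℝ}
    (hz : ∀ᵐ y, y ∉ Metric.closedBall 0 R → u y = 0) (p : MvPolynomial (Fin n) ℝ) :
    ∃ P ∈ homogeneousSum n m, P.1 = polyConv p u ∧
      (diracOp α P).1 = polyConv p (weakDirac α u) := by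
  obtain ⟨P, hPm, hP, hP'⟩ := HardyDirac.exists_homogeneousSum_polyConv p
    (integrable_of_memLp_two hu.1 hz) hz
  refine ⟨P, hPm, funext hP, funext fun x => ?_⟩
  have hg : ∀ j, Integrable fun y => polyEval p (x - y) • weakPartialDeriv j u y := fun j =>
    have hj := (hu.hasWeakPartialDeriv j).ae_eq_zero Metric.isClosed_closedBall hz
    integrable_polyConv p (integrable_of_memLp_two (hu.memLp_weakPartialDeriv j) hj) hj x
  have e : ∀ y, polyEval p (x - y) • weakDirac α u y =
      ∑ j, (α j).toEuclideanLin.toContinuousLinearMap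
        (polyEval p (x - y) • weakPartialDeriv j u y) := by
    intro y
    rw [weakDirac, Finset.smul_sum]
    refine Finset.sum_congr rfl fun j _ => ?_
    rw [← Complex.coe_smul, ← Complex.coe_smul, map_smul]
    rfl
  rw [polyConv]
  simp only [e]
  rw [integral_finsetSum _ fun j _ => ContinuousLinearMap.integrable_comp _ (hg j), diracOp,
    LinearMap.sum_apply, Smooth.val_sum, Finset.sum_apply]
  refine Finset.sum_congr rfl fun j _ => ?_
  rw [ContinuousLinearMap.integral_comp_comm _ (hg j), Module.End.mul_apply, matrixOp_apply, hP',
    (hu.hasWeakPartialDeriv j).polyConv_pderiv hz]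
  rfl

theorem IsProfile.exists_bound {ψ : ℝ → ℝ} (hψ : IsProfile ψ) : ∃ M, ∀ t, ‖ψ t‖ ≤ M :=
  hψ.hasCompactSupport.exists_bound_of_continuous hψ.contDiff.continuous

theorem IsProfile.memLp_smul {E : Type*} [NormedAddCommGroup E] [NormedSpace ℝ E] {ψ : ℝ → ℝ}
    (hψ : IsProfile ψ) {g : Dom n → E} (hg : Continuous g) :
    MemLp (fun x => ψ (‖x‖ ^ 2) • g x) 2 :=
  ((hψ.contDiff_radial n).continuous.smul hg).memLp_of_hasCompactSupport
    (hψ.hasCompactSupport_radial n).smul_right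

theorem memLp_of_bound_on {E F : Type*} [NormedAddCommGroup E] [NormedAddCommGroup F]
    {W : Dom n → E} {w : Dom n → F} {S : Set (Dom n)} (hS : MeasurableSet S) {M : ℝ}
    (hb : ∀ x ∈ S, ‖W x‖ ≤ M * ‖w x‖) (h0 : ∀ x, x ∉ S → W x = 0)
    (hW : AEStronglyMeasurable W) (hw : MemLp w 2) : MemLp W 2 :=
  ⟨hW, (eLpNorm_le_of_bound_on hS hb h0).trans_lt
    (ENNReal.mul_lt_top ENNReal.ofReal_lt_top (hw.restrict S).2)⟩

/-- The Hardy inequality for Sobolev functions, with a radial weight that on the support of the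
function is a power of the distance from the origin. -/
theorem MemW12.hardy {α : Fin n → Matrix (Fin m) (Fin m) ℂ} (hα : IsCliffordFamily α)
    (hn : 0 < n) {τ δ : ℝ} (hδ : 0 ≤ δ) (hc : ∀ μ : ℤ, δ ^ 2 ≤ (μ - (τ + n) / 2) ^ 2) {θ : ℝ → ℝ}
    (hθ : IsProfile θ) {R : ℝ} (hθR : ∀ x : Dom n, x ∉ Metric.closedBall 0 R → ‖x‖ ^ 2 ∉ tsupport θ)
    {u : Dom n → Spinor m} (hu : MemW12 u)
    (hz : ∀ᵐ y, y ∉ Metric.closedBall 0 R → u y = 0)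
    (hθu : ∀ᵐ x, (eulerProfile θ (‖x‖ ^ 2) - τ / 2 * θ (‖x‖ ^ 2)) • u x = 0) :
    MemLp (fun x => θ (‖x‖ ^ 2) • u x) 2 ∧
      MemLp (fun x => θ (‖x‖ ^ 2) • cliffordMul α x (weakDirac α u x)) 2 ∧
      δ ^ 2 * ∫ x, ‖θ (‖x‖ ^ 2) • u x‖ ^ 2 ≤
        ∫ x, ‖θ (‖x‖ ^ 2) • cliffordMul α x (weakDirac α u x)‖ ^ 2 := by
  set f := weakDirac α u with hf
  set B : Set (Dom n) := Metric.closedBall 0 R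
  have hBm : MeasurableSet B := Metric.isClosed_closedBall.measurableSet
  have hf2 : MemLp f 2 := hu.memLp_weakDirac α
  have hfz := hu.weakDirac_ae_eq_zero α Metric.isClosed_closedBall hz
  obtain ⟨M, hM⟩ := hθ.exists_bound
  obtain ⟨N, hN⟩ := hθ.euler.exists_bound
  have hM0 : 0 ≤ M := (norm_nonneg _).trans (hM 0)
  have hθ0 : ∀ x : Dom n, x ∉ B → θ (‖x‖ ^ 2) = 0 := fun x hx =>
    image_eq_zero_of_notMem_tsupport (hθR x hx)
  have hζ0 : ∀ x : Dom n, x ∉ B → eulerProfile θ (‖x‖ ^ 2) = 0 := fun x hx => by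
    rw [eulerProfile, image_eq_zero_of_notMem_tsupport
      fun h => hθR x hx (tsupport_deriv_subset h), mul_zero]
  have hbound : ∀ w : Dom n → Spinor m, ∀ x ∈ B, ‖θ (‖x‖ ^ 2) • w x‖ ≤ M * ‖w x‖ :=
    fun w x _ => by
      rw [norm_smul]
      exact mul_le_mul_of_nonneg_right (hM _) (norm_nonneg _)
  have hboundX : ∀ w : Dom n → Spinor m, ∀ x ∈ B,
      ‖θ (‖x‖ ^ 2) • cliffordMul α x (w x)‖ ≤ M * R * ‖w x‖ := fun w x hx => by
    rw [norm_smul, norm_cliffordMul hα, mul_assoc]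
    refine mul_le_mul (hM _) ?_ (by positivity) hM0
    exact mul_le_mul_of_nonneg_right (mem_closedBall_zero_iff.1 hx) (norm_nonneg _)
  have hboundζ : ∀ w : Dom n → Spinor m, ∀ x ∈ B,
      ‖(eulerProfile θ (‖x‖ ^ 2) - τ / 2 * θ (‖x‖ ^ 2)) • w x‖ ≤ (N + |τ / 2| * M) * ‖w x‖ :=
    fun w x _ => by
      rw [norm_smul]
      refine mul_le_mul_of_nonneg_right ((norm_sub_le _ _).trans (add_le_add (hN _) ?_))
        (norm_nonneg _)
      rw [norm_mul]
      exact mul_le_mul_of_nonneg_left (hM _) (norm_nonneg _)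
  have hθc := (hθ.contDiff_radial n).continuous
  have hζc := (hθ.euler.contDiff_radial n).continuous
  have hS : MemLp (fun x => θ (‖x‖ ^ 2) • u x) 2 :=
    memLp_of_bound_on hBm (hbound u) (fun x hx => by rw [hθ0 x hx, zero_smul])
      (hθc.aestronglyMeasurable.smul hu.1.aestronglyMeasurable) hu.1
  have hG : MemLp (fun x => θ (‖x‖ ^ 2) • cliffordMul α x (f x)) 2 :=
    memLp_of_bound_on hBm (hboundX f) (fun x hx => by rw [hθ0 x hx, zero_smul])
      (hθc.aestronglyMeasurable.smul
        (aestronglyMeasurable_cliffordMul α hf2.aestronglyMeasurable)) hf2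
  refine ⟨hS, hG, (mul_eLpNorm_two_le_iff hδ hS hG).1 ?_⟩
  refine ENNReal.le_of_forall_pos_le_add fun ε hε _ => ?_
  -- The sum of the factors multiplying the approximation error `ε / C` in the final chain; the
  -- extra `1` is harmless slack.
  set C : ℝ≥0∞ := ENNReal.ofReal δ * ENNReal.ofReal M +
    (ENNReal.ofReal (N + |τ / 2| * M) + ENNReal.ofReal (M * R)) + 1 with hC
  have hη : (ε : ℝ≥0∞) / C ≠ 0 :=
    (ENNReal.div_pos (by exact_mod_cast hε.ne') (by rw [hC]; finiteness)).ne'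
  obtain ⟨p, hp1, hp2⟩ := exists_polyConv_near hu.1 hf2 hz hfz hη
  obtain ⟨P, hPm, hP, hDP⟩ := hu.exists_homogeneousSum_polyConv α hz p
  rw [← hP] at hp1
  rw [← hDP] at hp2
  have hPc := P.contDiff.continuous
  have hPs : MemLp (fun x => θ (‖x‖ ^ 2) • P.1 x) 2 :=
    hθ.memLp_smul hPc
  have hLs : MemLp (fun x => θ (‖x‖ ^ 2) • (cliffordMul α x ((diracOp α P).1 x) -
      (τ / 2) • P.1 x) + eulerProfile θ (‖x‖ ^ 2) • P.1 x) 2 := by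
    have hXc : Continuous fun x => cliffordMul α x ((diracOp α P).1 x) := by
      simp only [← positionOp_apply]
      exact (positionOp α (diracOp α P)).contDiff.continuous
    have hτc : Continuous fun x => (τ / 2) • P.1 x := hPc.const_smul (τ / 2)
    exact (hθ.memLp_smul (hXc.sub hτc)).add (hθ.euler.memLp_smul hPc)
  have hmain := (mul_eLpNorm_two_le_iff hδ hPs hLs).2 (hardy_homogeneousSum hα hn hc hθ hPm)
  have hdiff : AEStronglyMeasurable (P.1 - u) volume :=
    hPc.aestronglyMeasurable.sub hu.1.aestronglyMeasurable
  have hdiffD : AEStronglyMeasurable ((diracOp α P).1 - f) volume :=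
    (diracOp α P).contDiff.continuous.aestronglyMeasurable.sub hf2.aestronglyMeasurable
  have h0 : eLpNorm (fun x => θ (‖x‖ ^ 2) • u x) 2 volume ≤
      eLpNorm (fun x => θ (‖x‖ ^ 2) • P.1 x) 2 volume + ENNReal.ofReal M * (ε / C) := by
    have e : (fun x => θ (‖x‖ ^ 2) • u x) =
        (fun x => θ (‖x‖ ^ 2) • P.1 x) - fun x => θ (‖x‖ ^ 2) • (P.1 - u) x := by
      funext x
      simp [smul_sub]
    rw [e]
    refine (eLpNorm_sub_le hPs.1 (hθc.aestronglyMeasurable.smul hdiff) one_le_two).trans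
      (add_le_add_right ((eLpNorm_le_of_bound_on hBm (hbound (P.1 - u))
        fun x hx => by rw [hθ0 x hx, zero_smul]).trans ?_) _)
    gcongr
  have h1 : eLpNorm (fun x => θ (‖x‖ ^ 2) • (cliffordMul α x ((diracOp α P).1 x) -
      (τ / 2) • P.1 x) + eulerProfile θ (‖x‖ ^ 2) • P.1 x) 2 volume ≤
      eLpNorm (fun x => θ (‖x‖ ^ 2) • cliffordMul α x (f x)) 2 volume +
        (ENNReal.ofReal (N + |τ / 2| * M) * (ε / C) + ENNReal.ofReal (M * R) * (ε / C)) := by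
    -- `hθu` lets `u` be subtracted for free in the zeroth-order term, so every error involves only
    -- `P - u` or `DP - Du`.
    have e : (fun x => θ (‖x‖ ^ 2) • (cliffordMul α x ((diracOp α P).1 x) -
        (τ / 2) • P.1 x) + eulerProfile θ (‖x‖ ^ 2) • P.1 x) =ᵐ[volume]
        (fun x => θ (‖x‖ ^ 2) • cliffordMul α x (f x)) +
        ((fun x => (eulerProfile θ (‖x‖ ^ 2) - τ / 2 * θ (‖x‖ ^ 2)) • (P.1 - u) x) +
          fun x => θ (‖x‖ ^ 2) • cliffordMul α x (((diracOp α P).1 - f) x)) := by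
      filter_upwards [hθu] with x hx
      simp only [Pi.add_apply, Pi.sub_apply, map_sub]
      rw [smul_sub _ (P.1 x) (u x), hx]
      module
    rw [eLpNorm_congr_ae e]
    have hm1 : AEStronglyMeasurable (fun x : Dom n =>
        (eulerProfile θ (‖x‖ ^ 2) - τ / 2 * θ (‖x‖ ^ 2)) • (P.1 - u) x) volume :=
      (hζc.sub (continuous_const.mul hθc)).aestronglyMeasurable.smul hdiff
    have hm2 : AEStronglyMeasurable (fun x : Dom n =>
        θ (‖x‖ ^ 2) • cliffordMul α x (((diracOp α P).1 - f) x)) volume :=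
      hθc.aestronglyMeasurable.smul (aestronglyMeasurable_cliffordMul α hdiffD)
    refine (eLpNorm_add_le hG.1 (hm1.add hm2) one_le_two).trans (add_le_add_right
      ((eLpNorm_add_le hm1 hm2 one_le_two).trans (add_le_add ?_ ?_)) _)
    · refine (eLpNorm_le_of_bound_on hBm (hboundζ (P.1 - u)) fun x hx => by
        rw [hθ0 x hx, hζ0 x hx, mul_zero, sub_zero, zero_smul]).trans ?_
      gcongr
    · refine (eLpNorm_le_of_bound_on hBm (hboundX ((diracOp α P).1 - f)) fun x hx => by
        rw [hθ0 x hx, zero_smul]).trans ?_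
      gcongr
  calc ENNReal.ofReal δ * eLpNorm (fun x => θ (‖x‖ ^ 2) • u x) 2 volume
      ≤ ENNReal.ofReal δ * (eLpNorm (fun x => θ (‖x‖ ^ 2) • P.1 x) 2 volume +
          ENNReal.ofReal M * (ε / C)) := by gcongr
    _ ≤ eLpNorm (fun x => θ (‖x‖ ^ 2) • cliffordMul α x (f x)) 2 volume +
        (ENNReal.ofReal (N + |τ / 2| * M) * (ε / C) + ENNReal.ofReal (M * R) * (ε / C)) +
        ENNReal.ofReal δ * (ENNReal.ofReal M * (ε / C)) := by
        rw [mul_add]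
        exact add_le_add_left (hmain.trans h1) _
    _ ≤ eLpNorm (fun x => θ (‖x‖ ^ 2) • cliffordMul α x (f x)) 2 volume + C * (ε / C) := by
        rw [add_assoc]
        refine add_le_add_right ?_ _
        generalize (ε : ℝ≥0∞) / C = η
        have e : C * η = ENNReal.ofReal (N + |τ / 2| * M) * η + ENNReal.ofReal (M * R) * η +
            ENNReal.ofReal δ * (ENNReal.ofReal M * η) + η := by
          rw [hC]; ring
        exact le_self_add.trans_eq e.symm
    _ ≤ _ := add_le_add_right ENNReal.mul_div_le _

end Limit

/-! ### The power weight, the gap and the conclusion -/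

/-- A profile that equals a given power on a compact subinterval of `(0, ∞)`. -/
theorem exists_profile_eq_rpow {a b : ℝ} (ha : 0 < a) (hab : a ≤ b) (s : ℝ) :
    ∃ θ : ℝ → ℝ, IsProfile θ ∧ (∀ t, 2 * b < t → t ∉ tsupport θ) ∧
      ∀ t ∈ Set.Icc a b, θ =ᶠ[nhds t] fun t => t ^ s := by
  -- The bump is `1` on `[a - a/4, b + a/4]` and supported in `[a/2, b + a/2]`, away from the
  -- singularity of `t ^ s` at `0` and below `2b`.
  let φ : ContDiffBump ((a + b) / 2 : ℝ) :=
    ⟨(b - a) / 2 + a / 4, (b - a) / 2 + a / 2, by linarith, by linarith⟩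
  have hts : tsupport φ = Metric.closedBall ((a + b) / 2) ((b - a) / 2 + a / 2) := φ.tsupport_eq
  have hsub : tsupport (fun t => t ^ s * φ t) ⊆ tsupport φ :=
    tsupport_mul_subset_right (f := fun t : ℝ => t ^ s) (g := φ)
  refine ⟨fun t => t ^ s * φ t, ⟨?_, φ.hasCompactSupport.mul_left⟩, fun t ht h => ?_,
    fun t ht => ?_⟩
  · rw [contDiff_iff_contDiffAt]
    intro t
    by_cases h0 : t = 0
    · have hn : t ∉ tsupport (fun t => t ^ s * φ t) := fun h => by
        have h2 := hsub h
        rw [hts, Metric.mem_closedBall, Real.dist_eq, h0, zero_sub, abs_neg] at h2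
        linarith [le_abs_self ((a + b) / 2)]
      have he := notMem_tsupport_iff_eventuallyEq.1 hn
      exact contDiffAt_const.congr_of_eventuallyEq he
    · exact (Real.contDiffAt_rpow_const_of_ne h0).mul φ.contDiff.contDiffAt
  · have h2 := hsub h
    rw [hts, Metric.mem_closedBall, Real.dist_eq] at h2
    linarith [le_abs_self (t - (a + b) / 2)]
  · have hb : t ∈ Metric.ball ((a + b) / 2) φ.rIn := by
      change t ∈ Metric.ball _ ((b - a) / 2 + a / 4)
      rw [Metric.mem_ball, Real.dist_eq, abs_lt]
      constructor <;> linarith [ht.1, ht.2]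
    filter_upwards [φ.eventuallyEq_one_of_mem_ball hb] with y hy
    rw [hy, Pi.one_apply, mul_one]

theorem isLeast_gapSet (n : ℕ) (τ : ℝ) : IsLeast (gapSet n τ) (gap n τ) := by
  -- The minimum is attained at the integer nearest to `(τ + n)/2`.
  have h : IsLeast (gapSet n τ) |τ + n - 2 * (round ((τ + n) / 2) : ℤ)| := by
    refine ⟨⟨_, rfl⟩, ?_⟩
    rintro _ ⟨k, rfl⟩
    have hk := round_le ((τ + n) / 2) k
    have e : ∀ z : ℤ, |τ + n - 2 * z| = 2 * |(τ + n) / 2 - z| := fun z => by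
      rw [← abs_two, ← abs_mul, abs_two]
      congr 1; ring
    simp only [e]
    linarith
  rwa [gap, h.csInf_eq]

theorem gap_pos {n : ℕ} {τ : ℝ} (hτ : ∀ k : ℤ, τ ≠ 2 * k - n) : 0 < gap n τ := by
  obtain ⟨k, hk⟩ := (isLeast_gapSet n τ).1
  rw [← hk, abs_pos]
  intro h
  exact hτ k (by linarith)

theorem gap_div_two_sq_le (n : ℕ) (τ : ℝ) (hg : 0 ≤ gap n τ) (μ : ℤ) :
    (gap n τ / 2) ^ 2 ≤ (μ - (τ + n) / 2) ^ 2 := by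
  have h := (isLeast_gapSet n τ).2 ⟨μ, rfl⟩
  have h2 := pow_le_pow_left₀ hg h 2
  rw [sq_abs] at h2
  linarith

end HardyDirac

theorem theorem5p1 (n m : ℕ) (hn : 1 < n)
    (α : Fin n → Matrix (Fin m) (Fin m) ℂ) (hα : HardyDirac.IsCliffordFamily α)
    (τ : ℝ) (hτ : ∀ k : ℤ, τ ≠ 2 * k - n) :
    -- `d` is a minimum and the constant `d² / 4` is positive
    IsLeast (HardyDirac.gapSet n τ) (HardyDirac.gap n τ) ∧
    0 < HardyDirac.gap n τ ^ 2 / 4 ∧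
    ∀ u : HardyDirac.Dom n → HardyDirac.Spinor m,
      HardyDirac.MemW12 u → HardyDirac.HasCompactSupportAwayFromZero u →
      -- both integrals are finite
      Integrable (fun x => ‖x‖ ^ τ * ‖u x‖ ^ 2) ∧
      Integrable (fun x => ‖x‖ ^ (τ + 2) * ‖HardyDirac.masslessDirac α u x‖ ^ 2) ∧
      (HardyDirac.gap n τ ^ 2 / 4) * ∫ x, ‖x‖ ^ τ * ‖u x‖ ^ 2 ≤
        ∫ x, ‖x‖ ^ (τ + 2) * ‖HardyDirac.masslessDirac α u x‖ ^ 2 := by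
  have hgap := HardyDirac.gap_pos hτ
  refine ⟨HardyDirac.isLeast_gapSet n τ, by positivity, fun u hu hK => ?_⟩
  obtain ⟨K, hKc, hK0, hKu⟩ := hK
  obtain ⟨r, hr, hrK⟩ : ∃ r > 0, ∀ x ∈ K, r ≤ ‖x‖ := by
    obtain ⟨r, hr, hb⟩ := Metric.mem_nhds_iff.1 (hKc.isClosed.isOpen_compl.mem_nhds hK0)
    refine ⟨r, hr, fun x hx => ?_⟩
    by_contra hlt
    exact hb (mem_ball_zero_iff.2 (not_le.1 hlt)) hx
  obtain ⟨R, hRr, hRK⟩ : ∃ R ≥ r, ∀ x ∈ K, ‖x‖ ≤ R := by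
    obtain ⟨R, hR⟩ := hKc.isBounded.exists_norm_le
    exact ⟨max R r, le_max_right _ _, fun x hx => (hR x hx).trans (le_max_left _ _)⟩
  -- Exponent `τ/4` because `θ` is evaluated at `|x|²` and then squared: `θ(|x|²)² = |x|^τ` on `K`.
  obtain ⟨θ, hθ, hθs, hθp⟩ := HardyDirac.exists_profile_eq_rpow (a := r ^ 2) (b := R ^ 2)
    (by positivity) (pow_le_pow_left₀ hr.le hRr 2) (τ / 4)
  have hmem : ∀ x ∈ K, ‖x‖ ^ 2 ∈ Set.Icc (r ^ 2) (R ^ 2) := fun x hx =>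
    ⟨pow_le_pow_left₀ hr.le (hrK x hx) 2, pow_le_pow_left₀ (norm_nonneg _) (hRK x hx) 2⟩
  have hθK : ∀ x ∈ K, θ (‖x‖ ^ 2) ^ 2 = ‖x‖ ^ τ := fun x hx => by
    rw [(hθp _ (hmem x hx)).eq_of_nhds, ← Real.rpow_natCast, ← Real.rpow_natCast, ← Real.rpow_mul
      (norm_nonneg x), ← Real.rpow_mul (norm_nonneg x)]
    congr 1; push_cast; ring
  have hθR : ∀ x : HardyDirac.Dom n, x ∉ Metric.closedBall 0 (2 * R) →
      ‖x‖ ^ 2 ∉ tsupport θ := fun x hx => hθs _ (by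
    rw [mem_closedBall_zero_iff, not_le] at hx
    nlinarith)
  have hz : ∀ᵐ y, y ∉ Metric.closedBall 0 (2 * R) → u y = 0 := hKu.mono fun y hy hyB =>
    hy fun hyK => hyB (mem_closedBall_zero_iff.2 (by linarith [hRK y hyK]))
  -- For a pure power `t^{τ/4}` one has `2tθ' = (τ/2)θ`, which is exactly the shift `τ/2` of the
  -- conjugated operator; equality of germs allows differentiating.
  have hθu : ∀ᵐ x, (HardyDirac.eulerProfile θ (‖x‖ ^ 2) - τ / 2 * θ (‖x‖ ^ 2)) • u x = 0 := by
    refine hKu.mono fun x hx => ?_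
    by_cases hxK : x ∈ K
    · have hpos : 0 < ‖x‖ ^ 2 := lt_of_lt_of_le (by positivity) (hmem x hxK).1
      have he := hθp _ (hmem x hxK)
      rw [HardyDirac.eulerProfile, he.deriv_eq, he.eq_of_nhds,
        Real.deriv_rpow_const, Real.rpow_sub_one hpos.ne']
      have : 2 * ‖x‖ ^ 2 * (τ / 4 * ((‖x‖ ^ 2) ^ (τ / 4) / ‖x‖ ^ 2)) -
          τ / 2 * (‖x‖ ^ 2) ^ (τ / 4) = 0 := by
        generalize ‖x‖ ^ 2 = t at hpos
        field_simp
        ring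
      rw [this, zero_smul]
    · rw [hx hxK, smul_zero]
  obtain ⟨hS, hG, hle⟩ := hu.hardy hα (by omega) (half_pos hgap).le
    (HardyDirac.gap_div_two_sq_le n τ hgap.le) hθ hθR hz hθu
  have e1 : (fun x => ‖θ (‖x‖ ^ 2) • u x‖ ^ 2) =ᵐ[volume] fun x => ‖x‖ ^ τ * ‖u x‖ ^ 2 := by
    filter_upwards [hKu] with x hx
    rw [norm_smul, mul_pow, Real.norm_eq_abs, sq_abs]
    by_cases hxK : x ∈ K
    · rw [hθK x hxK]
    · simp [hx hxK]
  -- Clifford multiplication by `x` supplies the additional factor `|x|²`.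
  have e2 : (fun x => ‖θ (‖x‖ ^ 2) • HardyDirac.cliffordMul α x (HardyDirac.weakDirac α u x)‖ ^ 2)
      =ᵐ[volume] fun x => ‖x‖ ^ (τ + 2) * ‖HardyDirac.masslessDirac α u x‖ ^ 2 := by
    filter_upwards [hu.weakDirac_ae_eq_zero α hKc.isClosed hKu] with x hx
    rw [norm_smul, mul_pow, Real.norm_eq_abs, sq_abs, HardyDirac.norm_cliffordMul hα, mul_pow,
      HardyDirac.norm_masslessDirac]
    by_cases hxK : x ∈ K
    · rw [hθK x hxK, Real.rpow_add (hr.trans_le (hrK x hxK)), Real.rpow_two, mul_assoc]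
    · simp [hx hxK]
  refine ⟨(HardyDirac.integrable_norm_sq_of_memLp hS).congr e1,
    (HardyDirac.integrable_norm_sq_of_memLp hG).congr e2, ?_⟩
  rw [integral_congr_ae e1, integral_congr_ae e2, div_pow] at hle
  norm_num at hle
  exact hle
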